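/- Write $M_n(\mathbb C)^g$ for the $g$-tuples of complex $n\times n$ matrices. For $A\in M_d(\mathbb C)^g$ and $X\in M_n(\mathbb C)^g$ let $\Lambda_A(X)=\sum_{j=1}^g A_j\otimes X_j$ and $L_A(X)=I-\Lambda_A(X)-\Lambda_A(X)^*$. The free spectrahedron $\mathcal D_A$ is the sequence of sets $\mathcal D_A[n]=\{X\in M_n(\mathbb C)^g: L_A(X)\succeq 0\}$, and $\mathfrak P_A$ is the sequence of sets $\mathfrak P_A[n]=\{X\in M_n(\mathbb C)^g: L_A(X)\succ 0\}$. The free spectrahedron $\mathcal D_A$ is circular if $\gamma X\in\mathcal D_A[n]$ for all $n$, all $X\in\mathcal D_A[n]$ and all $\gamma\in\mathbb C$ with $|\gamma|=1$. A free map $f:\mathfrak P_A\to\mathfrak P_B$ is a sequence of maps $f[n]:\mathfrak P_A[n]\to\mathfrak P_B[n]$ such that $f[n+m](X\oplus Y)=f[n](X)\oplus f[m](Y)$ for $X\in\mathfrak P_A[n]$, $Y\in\mathfrak P_A[m]$, and $f[n](U^*XU)=U^*f[n](X)U$ for $X\in\mathfrak P_A[n]$ and $n\times n$ unitary matrices $U$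 (operations on tuples are coordinatewise). It is analytic if every $f[n]$ is analytic, and it is a free biholomorphism if it is analytic and has an inverse that is an analytic free map $\mathfrak P_B\to\mathfrak P_A$. The free bidisk is the sequence of sets $\{(X_1,X_2)\in M_n(\mathbb C)^2:\|X_1\|<1,\ \|X_2\|<1\}$, with the operator norm. Let $k,m,l$ be positive integers, let $C_1\in M_{k,m}(\mathbb C)$ and $C_2\in M_{m,l}(\mathbb C)$ have operator norm $\|C_1\|=\|C_2\|=1$, and let $E=(E_1,E_2)$ with $$E_1=\begin{pmatrix}0&C_1&0\\0&0&0\\0&0&0\end{pmatrix},\qquad E_2=\begin{pmatrix}0&0&0\\0&0&C_2\\0&0&0\end{pmatrix},$$ block matrices of size $k+m+l$. Suppose $\mathfrak P_E$ is not the free bidisk, and let $B\in M_d(\mathbb C)^2$ be such that $\mathcal D_B$ is a circular free spectrahedron. If $f:\mathfrak P_E\to\mathfrak P_B$ is a free biholomorphism, then $f$ is linear: there is a matrix $(\mu_{ij})\in M_2(\mathbb C)$ such that $f(X)_i=\sum_{j=1}^2 \mu_{ij}X_j$ for $i=1,2$, all $n$ and all $X\in\mathfrak P_E[n]$. -/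

import Mathlib

open scoped ComplexOrder Kronecker Matrix Matrix.Norms.L2Operator

noncomputable section

/-- `g`-tuples of complex `n × n` matrices. Matrices carry the operator norm with respect to the
Euclidean norms. (Level `n = 0` is a single point, so allowing it is harmless.) -/
abbrev MatTuple (g n : ℕ) : Type := Fin g → Matrix (Fin n) (Fin n) ℂ

/-- `Λ_A(X) = ∑ j, A_j ⊗ X_j`. -/
def linPart {ι : Type*} {g n : ℕ} (A : Fin g → Matrix ι ι ℂ) (X : MatTuple g n) :
    Matrix (ι × Fin n) (ι × Fin n) ℂ :=
  ∑ j, A j ⊗ₖ X j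

/-- The monic linear pencil `L_A(X) = I - Λ_A(X) - Λ_A(X)^*`. -/
def pencil {ι : Type*} [DecidableEq ι] {g n : ℕ} (A : Fin g → Matrix ι ι ℂ) (X : MatTuple g n) :
    Matrix (ι × Fin n) (ι × Fin n) ℂ :=
  1 - linPart A X - (linPart A X)ᴴ

/-- A graded set: for each `n`, a set of `g`-tuples of `n × n` matrices. -/
abbrev GradedSet (g : ℕ) : Type := (n : ℕ) → Set (MatTuple g n)

/-- The free spectrahedron `D_A`. -/
def freeSpectrahedron {ι : Type*} [DecidableEq ι] {g : ℕ} (A : Fin g → Matrix ι ι ℂ) :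
    GradedSet g :=
  fun _ => {X | (pencil A X).PosSemidef}

/-- The (levelwise) interior `P_A` of the free spectrahedron `D_A`. -/
def freeSpectrahedronInt {ι : Type*} [DecidableEq ι] {g : ℕ} (A : Fin g → Matrix ι ι ℂ) :
    GradedSet g :=
  fun _ => {X | (pencil A X).PosDef}

/-- `D` is circular: each level is invariant under multiplication by unimodular scalars. -/
def IsCircular {g : ℕ} (D : GradedSet g) : Prop :=
  ∀ (n : ℕ), ∀ X ∈ D n, ∀ γ : ℂ, ‖γ‖ = 1 → γ • X ∈ D n

/-- The free bidisk. -/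
def freeBidisk : GradedSet 2 :=
  fun _ => {X | ∀ j, ‖X j‖ < 1}

/-- The direct sum `X ⊕ Y` of tuples, coordinatewise block diagonal. -/
def tupleSum {g n m : ℕ} (X : MatTuple g n) (Y : MatTuple g m) : MatTuple g (n + m) :=
  fun j => Matrix.reindex finSumFinEquiv finSumFinEquiv (Matrix.fromBlocks (X j) 0 0 (Y j))

/-- The tuple `U^* X U`. -/
def tupleConj {g n : ℕ} (U : Matrix (Fin n) (Fin n) ℂ) (X : MatTuple g n) : MatTuple g n :=
  fun j => Uᴴ * X j * U

/-- `f` is a free map from `S` to `T`. Only the values of `f n` on `S n` are constrained. -/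
structure IsFreeMap {g : ℕ} (S T : GradedSet g) (f : (n : ℕ) → MatTuple g n → MatTuple g n) :
    Prop where
  mapsTo : ∀ n, Set.MapsTo (f n) (S n) (T n)
  map_sum : ∀ n m, ∀ X ∈ S n, ∀ Y ∈ S m, f (n + m) (tupleSum X Y) = tupleSum (f n X) (f m Y)
  map_conj : ∀ n, ∀ X ∈ S n, ∀ U ∈ Matrix.unitaryGroup (Fin n) ℂ,
    f n (tupleConj U X) = tupleConj U (f n X)

/-- `f` is an analytic free map from `S` to `T`. -/
structure IsFreeAnalyticMap {g : ℕ} (S T : GradedSet g)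
    (f : (n : ℕ) → MatTuple g n → MatTuple g n) : Prop extends IsFreeMap S T f where
  analytic : ∀ n, AnalyticOnNhd ℂ (f n) (S n)

/-- `f` is a free biholomorphism from `S` to `T`: an analytic free map with an analytic free
inverse. -/
def IsFreeBiholomorphism {g : ℕ} (S T : GradedSet g)
    (f : (n : ℕ) → MatTuple g n → MatTuple g n) : Prop :=
  IsFreeAnalyticMap S T f ∧
    ∃ h : (n : ℕ) → MatTuple g n → MatTuple g n, IsFreeAnalyticMap T S h ∧
      ∀ n, Set.InvOn (h n) (f n) (S n) (T n)

/-- `f` is linear on `S`: there are scalars `M j k`, the same at every level, with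
`f(X)_j = ∑ k, M j k X_k` for `X` in `S`. -/
def IsFreeLinearOn {g : ℕ} (S : GradedSet g) (f : (n : ℕ) → MatTuple g n → MatTuple g n) : Prop :=
  ∃ M : Matrix (Fin g) (Fin g) ℂ, ∀ n, ∀ X ∈ S n, ∀ j, f n X j = ∑ k, M j k • X k

/-- The pair `E = (E₁, E₂)` of `3 × 3` block matrices with `C₁` in block position `(1,2)` of `E₁`
and `C₂` in block position `(2,3)` of `E₂`, and all other blocks zero. -/
def pairE {k m l : ℕ} (C₁ : Matrix (Fin k) (Fin m) ℂ) (C₂ : Matrix (Fin m) (Fin l) ℂ) :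
    Fin 2 → Matrix (Fin k ⊕ (Fin m ⊕ Fin l)) (Fin k ⊕ (Fin m ⊕ Fin l)) ℂ :=
  ![Matrix.fromBlocks 0 (Matrix.fromCols C₁ 0) 0 0,
    Matrix.fromBlocks 0 0 0 (Matrix.fromBlocks 0 C₂ 0 0)]

end

/-! A Schur complement removes the two outer blocks of the pencil: X lies in P_E exactly when ‖(C₁ ⊗
X₁)V‖² + ‖(C₂ᴴ ⊗ X₂ᴴ)V‖² < ‖V‖² for all V ≠ 0 (`mem_freeSpectrahedronInt_pairE`). Hence P_E is
balanced and bounded, and it is the free bidisk as soon as ‖C₁w‖² + ‖C₂ᴴw‖² ≤ ‖w‖² for all w. So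
some w violates this inequality.

Everything reduces to f(0) = 0. Let h be the inverse of f. If f(0) = 0, then X ↦ γ⁻¹h(γf(X)) is a
self-map of the bounded convex set P_E that is tangent to the identity at 0, so it is the identity
by Cartan's theorem. Thus f commutes with rotations, agrees with its derivative at 0, and direct
sums together with unitary conjugation force that derivative to have scalar coefficients
(`free_linear_eq`).

To locate f(0), differentiate the flow X ↦ h(γf(X)) in γ = exp(iθ) at θ = 0. The velocity v
satisfies v(0) = Dh(f(0))(i f(0)) with Dh(f(0)) injective, so v(0) = 0 gives f(0) = 0. The flow
preserves P_E, so v has to be tangent to the boundary. This is tested at pairs of 4 × 4 weighted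
shifts, where the boundary is described by contact points: weights (s, t) with s‖C₁w‖² + t‖C₂ᴴw‖² ≤
‖w‖² for all w and equality at some u ≠ 0. Conjugation by diagonal unitaries makes the entries of
flow and field homogeneous in the weights; so they extend to these boundary points even if f does
not, and the entries that matter depend on a few constants only (`IsEquivariantOn.exists_entry_eq`).

Tangency becomes a family of identities indexed by pairs of contact points
(`rotationField_tangency`). By `eq_zero_of_contact_relations` they force the diagonal entries of
v(0) to vanish: otherwise there would be infinitely many orthogonal contact vectors in a
finite-dimensional space, or the bidisk inequality would hold. -/

/-! ### Homogeneity on discs and Cartan's uniqueness theorem -/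

section Analysis

open Metric Set Filter Topology

variable {E F : Type*} [NormedAddCommGroup E] [NormedSpace ℂ E]
  [NormedAddCommGroup F] [NormedSpace ℂ F]

/-- A function on the closed unit disc that is `z ^ k • c` on the circle is so on the disc. -/
theorem eq_pow_smul_of_circle {G : ℂ → F} {c : F} {k : ℕ}
    (hG : ∀ z : ℂ, ‖z‖ ≤ 1 → DifferentiableAt ℂ G z)
    (hc : ∀ z : ℂ, ‖z‖ = 1 → G z = z ^ k • c) {z : ℂ} (hz : ‖z‖ ≤ 1) : G z = z ^ k • c := by
  have h1 : DiffContOnCl ℂ G (ball 0 1) := by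
    refine DifferentiableOn.diffContOnCl fun w hw => (hG w ?_).differentiableWithinAt
    simpa using closure_ball_subset_closedBall hw
  have h2 : DiffContOnCl ℂ (fun z : ℂ => z ^ k • c) (ball 0 1) :=
    Differentiable.diffContOnCl (by fun_prop)
  have h3 : EqOn G (fun z : ℂ => z ^ k • c) (frontier (ball 0 1)) := by
    intro w hw
    rw [frontier_ball _ one_ne_zero] at hw
    exact hc w (by simpa using hw)
  refine Complex.eqOn_closure_of_eqOn_frontier isBounded_ball h1 h2 h3 ?_
  rw [closure_ball _ one_ne_zero]
  simpa using hz

/-- A function that is homogeneous of degree one along the ray of `x` and differentiable at `0`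
is given at `x` by its derivative at `0`. -/
theorem eq_fderiv_of_homogeneous {g : E → F} {x : E} (hg : DifferentiableAt ℂ g 0)
    (hx : ∀ z : ℂ, ‖z‖ ≤ 1 → g (z • x) = z • g x) : g x = fderiv ℂ g 0 x := by
  have h1 : HasDerivAt (fun z : ℂ => g (z • x)) (fderiv ℂ g 0 x) 0 := by
    have h2 : HasDerivAt (fun z : ℂ => z • x) x 0 := by
      simpa using (hasDerivAt_id (0 : ℂ)).smul_const x
    have h3 : HasFDerivAt g (fderiv ℂ g 0) ((0 : ℂ) • x) := by simpa using hg.hasFDerivAt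
    exact h3.comp_hasDerivAt (0 : ℂ) h2
  have h2 : HasDerivAt (fun z : ℂ => z • g x) (g x) 0 := by
    simpa using (hasDerivAt_id (0 : ℂ)).smul_const (g x)
  refine h2.unique (h1.congr_of_eventuallyEq ?_)
  filter_upwards [ball_mem_nhds (0 : ℂ) one_pos] with z hz
  exact (hx z (by simpa using (mem_ball_zero_iff.1 hz).le)).symm

/-- A bounded holomorphic function with vanishing derivative at `0` has small Lipschitz constant
near `0`, depending only on the bound and on the radius of the domain. -/
theorem norm_fderiv_le_of_bounded [CompleteSpace F] {g : E → F} {R ρ : ℝ} (hρ : 0 < ρ)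
    (hg : ∀ x ∈ ball (0 : E) ρ, AnalyticAt ℂ g x) (hR : ∀ x ∈ ball (0 : E) ρ, ‖g x‖ ≤ R)
    (h0 : fderiv ℂ g 0 = 0) {x : E} (hx : x ∈ ball (0 : E) (ρ / 2)) :
    ‖fderiv ℂ g x‖ ≤ 2 * R / (ρ / 2) / (ρ / 2) * ‖x‖ := by
  have hsub : ∀ y ∈ ball (0 : E) (ρ / 2), ball y (ρ / 2) ⊆ ball 0 ρ := by
    intro y hy w hw
    rw [mem_ball] at *
    linarith [dist_triangle w y 0]
  have hbd : ∀ y ∈ ball (0 : E) (ρ / 2), ‖fderiv ℂ g y‖ ≤ 2 * R / (ρ / 2) := by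
    intro y hy
    refine Complex.norm_fderiv_le_div_of_mapsTo_ball (c := y)
      (fun w hw => (hg w (hsub y hy hw)).differentiableAt.differentiableWithinAt) ?_ (half_pos hρ)
    intro w hw
    rw [mem_closedBall, dist_eq_norm]
    have h1 := hR w (hsub y hy hw)
    have h2 := hR y (hsub y hy (mem_ball_self (half_pos hρ)))
    linarith [norm_sub_le (g w) (g y)]
  -- Schwarz lemma for the derivative itself, which vanishes at 0 and is bounded by the Cauchy
  -- estimate `hbd`.
  have := Complex.dist_le_div_mul_dist_of_mapsTo_ball (f := fderiv ℂ g) (c := 0)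
    (R₁ := ρ / 2) (R₂ := 2 * R / (ρ / 2))
    (fun w hw => (hg w (ball_subset_ball (by linarith) hw)).fderiv.differentiableAt
      |>.differentiableWithinAt)
    (fun w hw => by simpa [h0] using hbd w hw) hx
  simpa [h0] using this

/-- **Cartan's uniqueness theorem** for convex sets: a holomorphic self-map of a bounded convex
neighbourhood of `0` that fixes `0` and is tangent to the identity there is the identity. -/
theorem cartan_uniqueness [CompleteSpace E] {U : Set E} {ψ : E → E} {R : ℝ} (hU : Convex ℝ U)
    (h0U : U ∈ 𝓝 (0 : E)) (hR : ∀ x ∈ U, ‖x‖ ≤ R) (hψ : AnalyticOnNhd ℂ ψ U)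
    (hmap : MapsTo ψ U U) (hψ0 : ψ 0 = 0) (hd : HasFDerivAt ψ (ContinuousLinearMap.id ℂ E) 0) :
    ∀ x ∈ U, ψ x = x := by
  obtain ⟨ρ, hρ, hball⟩ := Metric.mem_nhds_iff.1 h0U
  have hR0 : 0 ≤ R := (norm_nonneg _).trans (hR 0 (mem_of_mem_nhds h0U))
  have hit : ∀ j : ℕ, MapsTo ψ^[j] U U := fun j => hmap.iterate j
  have hitan : ∀ j : ℕ, AnalyticOnNhd ℂ ψ^[j] U := by
    intro j
    induction j with
    | zero => exact analyticOnNhd_id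
    | succ j ih =>
      rw [Function.iterate_succ']
      exact hψ.comp ih (hit j)
  have hit0 : ∀ j : ℕ, ψ^[j] 0 = 0 := fun j => Function.iterate_fixed hψ0 j
  have hitd : ∀ j : ℕ, HasFDerivAt ψ^[j] (ContinuousLinearMap.id ℂ E) 0 := by
    intro j
    have := hd.iterate hψ0 j
    rwa [show ContinuousLinearMap.id ℂ E = 1 from rfl, one_pow] at this
  -- the Cesàro means of the iterates, minus the identity
  let g : ℕ → E → E := fun J x => ((J : ℂ) + 1)⁻¹ • (∑ j ∈ Finset.range (J + 1), ψ^[j] x) - x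
  have hJ : ∀ J : ℕ, ((J : ℂ) + 1) ≠ 0 := fun J => by exact_mod_cast Nat.succ_ne_zero J
  have hJn : ∀ J : ℕ, ‖((J : ℂ) + 1)‖ = J + 1 := fun J => by
    have : ((J : ℂ) + 1) = ((J + 1 : ℕ) : ℂ) := by push_cast; ring
    rw [this, Complex.norm_natCast]; push_cast; ring
  have hgan : ∀ J, ∀ x ∈ ball (0 : E) ρ, AnalyticAt ℂ (g J) x := by
    intro J x hx
    refine AnalyticAt.sub ?_ analyticAt_id
    refine analyticAt_const.smul ?_
    have : AnalyticAt ℂ (∑ j ∈ Finset.range (J + 1), ψ^[j]) x :=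
      Finset.analyticAt_sum _ fun j _ => hitan j x (hball hx)
    convert this using 1
    ext y
    simp
  have hgbd : ∀ J, ∀ x ∈ ball (0 : E) ρ, ‖g J x‖ ≤ 2 * R := by
    intro J x hx
    have h1 : ‖∑ j ∈ Finset.range (J + 1), ψ^[j] x‖ ≤ (J + 1) * R := by
      refine (norm_sum_le_of_le _ fun j _ => hR _ (hit j (hball hx))).trans ?_
      simp
    have h2 : ‖((J : ℂ) + 1)⁻¹ • (∑ j ∈ Finset.range (J + 1), ψ^[j] x)‖ ≤ R := by
      rw [norm_smul, norm_inv, hJn, inv_mul_le_iff₀ (by positivity)]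
      exact h1
    linarith [norm_sub_le (((J : ℂ) + 1)⁻¹ • (∑ j ∈ Finset.range (J + 1), ψ^[j] x)) x,
      hR x (hball hx)]
  have hgd : ∀ J, fderiv ℂ (g J) 0 = 0 := by
    intro J
    have h1 : HasFDerivAt (fun x => ∑ j ∈ Finset.range (J + 1), ψ^[j] x)
        (∑ j ∈ Finset.range (J + 1), ContinuousLinearMap.id ℂ E) 0 :=
      HasFDerivAt.fun_sum fun j _ => hitd j
    have h2 := ((h1.const_smul ((J : ℂ) + 1)⁻¹).sub (hasFDerivAt_id (0 : E))).fderiv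
    refine Eq.trans h2 ?_
    ext x
    simp only [Finset.sum_const, Finset.card_range, sub_apply,
      smul_apply, ContinuousLinearMap.id_apply,
      zero_apply]
    rw [← Nat.cast_smul_eq_nsmul ℂ, smul_smul]
    push_cast
    rw [inv_mul_cancel₀ (hJ J), one_smul, sub_self]
  obtain ⟨δ, hδ, hδρ, hlip⟩ : ∃ δ > 0, δ ≤ ρ ∧ ∀ J, ∀ x ∈ ball (0 : E) δ, ∀ y ∈ ball (0 : E) δ,
      ‖g J y - g J x‖ ≤ 1 / 2 * ‖y - x‖ := by
    set K : ℝ := 2 * (2 * R) / (ρ / 2) / (ρ / 2) with hK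
    have hK0 : 0 ≤ K := by positivity
    -- The radius makes K‖z‖ ≤ 1/2. It does not depend on J, because all g J obey the same bound 2R.
    refine ⟨min (ρ / 2) (1 / (2 * (K + 1))), by positivity,
      (min_le_left _ _).trans (by linarith), ?_⟩
    intro J x hx y hy
    refine (convex_ball (0 : E) (min (ρ / 2) (1 / (2 * (K + 1))))).norm_image_sub_le_of_norm_fderiv_le
      (𝕜 := ℂ) ?_ ?_ hx hy
    · intro z hz
      refine (hgan J z ?_).differentiableAt
      exact ball_subset_ball ((min_le_left _ _).trans (by linarith)) hz
    · intro z hz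
      have hz1 : z ∈ ball (0 : E) (ρ / 2) := ball_subset_ball (min_le_left _ _) hz
      have hz2 : ‖z‖ ≤ 1 / (2 * (K + 1)) := by
        have := ball_subset_ball (min_le_right _ _) hz
        exact (mem_ball_zero_iff.1 this).le
      refine (norm_fderiv_le_of_bounded hρ (hgan J) (hgbd J) (hgd J) hz1).trans ?_
      rw [← hK]
      calc K * ‖z‖ ≤ K * (1 / (2 * (K + 1))) := by gcongr
        _ ≤ 1 / 2 := by
          rw [mul_one_div, div_le_div_iff₀ (by positivity) (by norm_num)]
          linarith
  have hnear : ∀ x ∈ ball (0 : E) δ, ψ x ∈ ball (0 : E) δ → ψ x = x := by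
    intro x hx hψx
    have hxU : x ∈ U := hball (ball_subset_ball hδρ hx)
    have key : ∀ J : ℕ, ‖ψ x - x‖ ≤ 4 * R * (1 / ((J : ℝ) + 1)) := by
      intro J
      -- The orbit sums at ψ x and at x telescope. With the Lipschitz constant 1/2 this gives ‖ψ x −
      -- x‖ ≤ 2R/(J + 1) + ‖ψ x − x‖/2.
      have h1 : g J (ψ x) - g J x
          = ((J : ℂ) + 1)⁻¹ • (ψ^[J + 1] x - x) - (ψ x - x) := by
        have h2 : ∑ j ∈ Finset.range (J + 1), ψ^[j] (ψ x)
            - ∑ j ∈ Finset.range (J + 1), ψ^[j] x = ψ^[J + 1] x - x := by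
          simp_rw [← Function.iterate_succ_apply]
          rw [← Finset.sum_sub_distrib, Finset.sum_range_sub (fun j => ψ^[j] x)]
          simp
        simp only [g]
        rw [← h2, smul_sub]
        abel
      have h3 := hlip J x hx (ψ x) hψx
      rw [h1] at h3
      have h4 : ‖((J : ℂ) + 1)⁻¹ • (ψ^[J + 1] x - x)‖ ≤ 2 * R * (1 / ((J : ℝ) + 1)) := by
        rw [norm_smul, norm_inv, hJn, mul_comm, one_div]
        gcongr
        linarith [norm_sub_le (ψ^[J + 1] x) x, hR _ (hit (J + 1) hxU), hR _ hxU]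
      have h5 : ‖ψ x - x‖ ≤ ‖((J : ℂ) + 1)⁻¹ • (ψ^[J + 1] x - x)‖
          + ‖((J : ℂ) + 1)⁻¹ • (ψ^[J + 1] x - x) - (ψ x - x)‖ := by
        have := norm_sub_le (((J : ℂ) + 1)⁻¹ • (ψ^[J + 1] x - x))
          (((J : ℂ) + 1)⁻¹ • (ψ^[J + 1] x - x) - (ψ x - x))
        simpa using this
      nlinarith
    have hlim : Tendsto (fun J : ℕ => 4 * R * (1 / ((J : ℝ) + 1))) atTop (𝓝 (4 * R * 0)) :=
      tendsto_one_div_add_atTop_nhds_zero_nat.const_mul _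
    have := ge_of_tendsto' hlim key
    rw [mul_zero] at this
    exact sub_eq_zero.1 (norm_le_zero_iff.1 this)
  have hev : ψ =ᶠ[𝓝 0] id := by
    have hc : ∀ᶠ x in 𝓝 (0 : E), ψ x ∈ ball (0 : E) δ := by
      refine hd.continuousAt.eventually_mem ?_
      rw [hψ0]
      exact ball_mem_nhds _ hδ
    filter_upwards [hc, ball_mem_nhds (0 : E) hδ] with x hx hx'
    exact hnear x hx' hx
  exact hψ.eqOn_of_preconnected_of_eventuallyEq analyticOnNhd_id hU.isPreconnected
    (mem_of_mem_nhds h0U) hev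

end Analysis

/-! ### Contact points of two quadratic forms -/

section Contact

open Metric Set Filter Topology

variable {H K₁ K₂ : Type*} [NormedAddCommGroup H] [InnerProductSpace ℂ H]
  [NormedAddCommGroup K₁] [InnerProductSpace ℂ K₁] [NormedAddCommGroup K₂]
  [InnerProductSpace ℂ K₂] {T₁ : H →L[ℂ] K₁} {T₂ : H →L[ℂ] K₂}

/-- The form `s ‖T₁ w‖² + t ‖T₂ w‖²` is dominated by `‖w‖²`, with equality at `u ≠ 0`. -/
structure IsContact (T₁ : H →L[ℂ] K₁) (T₂ : H →L[ℂ] K₂) (s t : ℝ) (u : H) : Prop where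
  s_nonneg : 0 ≤ s
  t_nonneg : 0 ≤ t
  le : ∀ w, s * ‖T₁ w‖ ^ 2 + t * ‖T₂ w‖ ^ 2 ≤ ‖w‖ ^ 2
  ne_zero : u ≠ 0
  eq : s * ‖T₁ u‖ ^ 2 + t * ‖T₂ u‖ ^ 2 = ‖u‖ ^ 2

theorem IsContact.swap {s t : ℝ} {u : H} (h : IsContact T₁ T₂ s t u) : IsContact T₂ T₁ t s u :=
  ⟨h.t_nonneg, h.s_nonneg, fun w => by linarith [h.le w], h.ne_zero, by linarith [h.eq]⟩

theorem eq_zero_of_forall_re_nonneg {N : ℂ} {R : ℝ}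
    (h : ∀ c : ℂ, 0 ≤ 2 * (c * N).re + ‖c‖ ^ 2 * R) : N = 0 := by
  by_contra hN
  have hN' : 0 < ‖N‖ ^ 2 := by positivity
  have key : ∀ δ : ℝ, 0 ≤ ‖N‖ ^ 2 * (-2 * δ + δ ^ 2 * R) := by
    intro δ
    -- This direction makes the linear term −2δ‖N‖², which dominates the quadratic term for small δ
    -- > 0.
    have := h (-(δ : ℂ) * (starRingEnd ℂ) N)
    have h1 : (-(δ : ℂ) * (starRingEnd ℂ) N * N) = ((-δ * ‖N‖ ^ 2 : ℝ) : ℂ) := by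
      rw [mul_assoc, mul_comm ((starRingEnd ℂ) N), Complex.mul_conj, Complex.normSq_eq_norm_sq]
      push_cast; ring
    rw [h1, Complex.ofReal_re] at this
    simp only [norm_mul, norm_neg, Complex.norm_real, RCLike.norm_conj, mul_pow, Real.norm_eq_abs,
      sq_abs] at this
    linarith
  have key' : ∀ δ : ℝ, 0 ≤ -2 * δ + δ ^ 2 * R := fun δ => nonneg_of_mul_nonneg_right (key δ) hN'
  have h2 := key' (1 / (|R| + 1))
  have h3 : 0 < |R| + 1 := by positivity
  have h4 : (-2 * (1 / (|R| + 1)) + (1 / (|R| + 1)) ^ 2 * R) * (|R| + 1) ^ 2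
      = -2 * (|R| + 1) + R := by field_simp
  have h5 := mul_nonneg h2 (sq_nonneg (|R| + 1))
  rw [h4] at h5
  linarith [le_abs_self R, abs_nonneg R]

theorem norm_add_smul_sq (x y : H) (c : ℂ) :
    ‖x + c • y‖ ^ 2 = ‖x‖ ^ 2 + 2 * (c * inner ℂ x y).re + ‖c‖ ^ 2 * ‖y‖ ^ 2 := by
  rw [norm_add_sq (𝕜 := ℂ), inner_smul_right, norm_smul, mul_pow]
  rfl

/-- First-order condition: the nonnegative form ‖w‖² − s‖T₁w‖² − t‖T₂w‖² attains its minimum 0 at u,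
so u lies in its kernel. -/
theorem IsContact.inner_eq {s t : ℝ} {u : H} (h : IsContact T₁ T₂ s t u) (w : H) :
    s * inner ℂ (T₁ w) (T₁ u) + t * inner ℂ (T₂ w) (T₂ u) = inner ℂ w u := by
  have : inner ℂ u w - s * inner ℂ (T₁ u) (T₁ w) - t * inner ℂ (T₂ u) (T₂ w) = 0 := by
    refine eq_zero_of_forall_re_nonneg
      (R := ‖w‖ ^ 2 - s * ‖T₁ w‖ ^ 2 - t * ‖T₂ w‖ ^ 2) fun c => ?_
    have h1 := h.le (u + c • w)
    rw [map_add, map_smul, map_add, map_smul, norm_add_smul_sq, norm_add_smul_sq,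
      norm_add_smul_sq] at h1
    have h2 : (c * (inner ℂ u w - s * inner ℂ (T₁ u) (T₁ w) - t * inner ℂ (T₂ u) (T₂ w))).re
        = (c * inner ℂ u w).re - s * (c * inner ℂ (T₁ u) (T₁ w)).re
          - t * (c * inner ℂ (T₂ u) (T₂ w)).re := by
      rw [← Complex.re_ofReal_mul, ← Complex.re_ofReal_mul, ← Complex.sub_re, ← Complex.sub_re]
      congr 1; ring
    rw [h2]
    linarith [h.eq]
  have h2 := congrArg (starRingEnd ℂ) this
  simp only [map_sub, map_mul, Complex.conj_ofReal, inner_conj_symm, map_zero] at h2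
  linear_combination -h2

/-- A continuous function positive on the unit sphere is bounded below there. -/
theorem exists_pos_le_of_sphere [FiniteDimensional ℂ H] {q : H → ℝ} (hq : Continuous q)
    (hhom : ∀ (c : ℂ) w, q (c • w) = ‖c‖ ^ 2 * q w) (hpos : ∀ w, w ≠ 0 → 0 < q w) :
    ∃ δ > 0, ∀ w, δ * ‖w‖ ^ 2 ≤ q w := by
  have : ProperSpace H := FiniteDimensional.proper ℂ H
  have hq0 : q 0 = 0 := by simpa using hhom 0 0
  rcases subsingleton_or_nontrivial H with hs | hn
  · exact ⟨1, one_pos, fun w => by simp [Subsingleton.elim w 0, hq0]⟩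
  have : NormedSpace ℝ H := NormedSpace.restrictScalars ℝ ℂ H
  have hne : (sphere (0 : H) 1).Nonempty := by
    obtain ⟨x, hx⟩ := exists_ne (0 : H)
    refine ⟨((‖x‖ : ℂ)⁻¹) • x, ?_⟩
    simp [norm_smul, hx]
  obtain ⟨x, hx, hmin⟩ := (isCompact_sphere (0 : H) 1).exists_isMinOn hne hq.continuousOn
  have hx1 : ‖x‖ = 1 := by simpa using hx
  refine ⟨q x, hpos x (by rintro rfl; simp at hx1), fun w => ?_⟩
  rcases eq_or_ne w 0 with rfl | hw
  · simp [hq0]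
  have h1 : ((‖w‖ : ℂ)⁻¹) • w ∈ sphere (0 : H) 1 := by simp [norm_smul, hw]
  have h2 := hmin h1
  simp only [mem_ofPred_eq] at h2
  rw [hhom, norm_inv, Complex.norm_real, norm_norm, inv_pow, ← div_eq_inv_mul,
    le_div_iff₀ (by positivity)] at h2
  exact h2

theorem opNorm_lt_one_of_forall_lt [FiniteDimensional ℂ H] (hT : ∀ w, w ≠ 0 → ‖T₁ w‖ < ‖w‖) :
    ‖T₁‖ < 1 := by
  obtain ⟨δ, hδ, h⟩ := exists_pos_le_of_sphere (q := fun w => ‖w‖ ^ 2 - ‖T₁ w‖ ^ 2)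
    (by fun_prop) (fun c w => by simp only [map_smul, norm_smul]; ring) (fun w hw => by
      have := hT w hw
      have h0 := norm_nonneg (T₁ w)
      simp only [sub_pos]
      gcongr)
  have h1 : ‖T₁‖ ≤ √(max 0 (1 - δ)) := by
    refine T₁.opNorm_le_bound (Real.sqrt_nonneg _) fun w => ?_
    refine le_of_sq_le_sq ?_ (by positivity)
    rw [mul_pow, Real.sq_sqrt (le_max_left _ _)]
    have := h w
    nlinarith [le_max_right 0 (1 - δ), sq_nonneg ‖w‖]
  have h2 : √(max 0 (1 - δ)) < 1 := by
    rw [Real.sqrt_lt' one_pos]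
    simp [hδ]
  linarith

theorem exists_norm_eq_of_opNorm_eq_one [FiniteDimensional ℂ H] (hT : ‖T₁‖ = 1) :
    ∃ e : H, e ≠ 0 ∧ ‖T₁ e‖ = ‖e‖ := by
  by_contra! hcon
  have hle : ∀ w, ‖T₁ w‖ ≤ ‖w‖ := fun w => by simpa [hT] using T₁.le_opNorm w
  exact (opNorm_lt_one_of_forall_lt fun w hw => lt_of_le_of_ne (hle w) (hcon w hw)).ne hT

/-- Take the largest admissible t. If no vector gave equality, compactness of the unit sphere would
leave a uniform slack δ, and t + δ would still be admissible since ‖T₂‖ = 1. -/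
theorem exists_isContact [FiniteDimensional ℂ H] (hT₁ : ‖T₁‖ = 1) (hT₂ : ‖T₂‖ = 1) {s : ℝ}
    (hs0 : 0 ≤ s) (hs1 : s ≤ 1) : ∃ t u, IsContact T₁ T₂ s t u := by
  obtain ⟨e, he, hTe⟩ := exists_norm_eq_of_opNorm_eq_one hT₂
  have hle : ∀ w, ‖T₁ w‖ ^ 2 ≤ ‖w‖ ^ 2 := fun w => by
    have : ‖T₁ w‖ ≤ ‖w‖ := by simpa [hT₁] using T₁.le_opNorm w
    gcongr
  have hle₂ : ∀ w, ‖T₂ w‖ ^ 2 ≤ ‖w‖ ^ 2 := fun w => by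
    have : ‖T₂ w‖ ≤ ‖w‖ := by simpa [hT₂] using T₂.le_opNorm w
    gcongr
  let A : Set ℝ := {t | 0 ≤ t ∧ ∀ w, s * ‖T₁ w‖ ^ 2 + t * ‖T₂ w‖ ^ 2 ≤ ‖w‖ ^ 2}
  have hA1 : A ⊆ Icc 0 1 := by
    rintro t ⟨ht0, ht⟩
    refine ⟨ht0, ?_⟩
    have h1 := ht e
    rw [hTe] at h1
    have h2 : 0 < ‖e‖ ^ 2 := by positivity
    nlinarith [mul_nonneg hs0 (sq_nonneg ‖T₁ e‖)]
  have hA2 : IsClosed A := by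
    have : A = Ici 0 ∩ ⋂ w, {t | s * ‖T₁ w‖ ^ 2 + t * ‖T₂ w‖ ^ 2 ≤ ‖w‖ ^ 2} := by
      ext t; simp [A]
    rw [this]
    refine isClosed_Ici.inter (isClosed_iInter fun w => isClosed_le (by fun_prop) (by fun_prop))
  have hA3 : (0 : ℝ) ∈ A := ⟨le_rfl, fun w => by nlinarith [hle w, sq_nonneg ‖T₁ w‖]⟩
  obtain ⟨t, ht, hmax⟩ := (isCompact_Icc.of_isClosed_subset hA2 hA1).exists_isMaxOn ⟨0, hA3⟩
    continuousOn_id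
  refine ⟨t, ?_⟩
  by_contra! hcon
  obtain ⟨δ, hδ, h⟩ := exists_pos_le_of_sphere
    (q := fun w => ‖w‖ ^ 2 - s * ‖T₁ w‖ ^ 2 - t * ‖T₂ w‖ ^ 2)
    (by fun_prop) (fun c w => by simp only [map_smul, norm_smul]; ring) (fun w hw => by
      by_contra hneg
      exact hcon w ⟨hs0, ht.1, ht.2, hw, le_antisymm (ht.2 w) (by linarith)⟩)
  have h1 : t + δ ∈ A := by
    refine ⟨by linarith [ht.1], fun w => ?_⟩
    have h2 := h w
    nlinarith [hle₂ w]
  have h2 := hmax h1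
  simp only [id, mem_ofPred_eq] at h2
  linarith

/-- If the coefficients satisfy the tangency relations at all pairs of contact points, then the
constant coefficient vanishes unless `‖T₁ w‖² + ‖T₂ w‖² ≤ ‖w‖²` for all `w`. -/
theorem eq_zero_of_contact_relations [FiniteDimensional ℂ H] (hT₁ : ‖T₁‖ = 1) (hT₂ : ‖T₂‖ = 1)
    (hne : ∃ w, ‖w‖ ^ 2 < ‖T₁ w‖ ^ 2 + ‖T₂ w‖ ^ 2) {α a b : ℂ}
    (hrel : ∀ s₁ t₁ u₁ s₂ t₂ u₂, IsContact T₁ T₂ s₁ t₁ u₁ → IsContact T₁ T₂ s₂ t₂ u₂ → 0 < s₁ →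
      (α + a * s₂) * inner ℂ (T₁ u₂) (T₁ u₁) + b * t₁ * inner ℂ (T₂ u₂) (T₂ u₁) = 0) :
    α = 0 := by
  by_contra hα
  have hle₁ : ∀ w, ‖T₁ w‖ ^ 2 ≤ ‖w‖ ^ 2 := fun w => by
    have : ‖T₁ w‖ ≤ ‖w‖ := by simpa [hT₁] using T₁.le_opNorm w
    gcongr
  have hle₂ : ∀ w, ‖T₂ w‖ ^ 2 ≤ ‖w‖ ^ 2 := fun w => by
    have : ‖T₂ w‖ ≤ ‖w‖ := by simpa [hT₂] using T₂.le_opNorm w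
    gcongr
  -- A vector at which T₁ attains its norm is a contact vector for the weights (1, 0), where the
  -- b-term drops out.
  have haα : a = -α := by
    obtain ⟨e, he, hTe⟩ := exists_norm_eq_of_opNorm_eq_one hT₁
    have hc : IsContact T₁ T₂ 1 0 e :=
      ⟨zero_le_one, le_rfl, fun w => by linarith [hle₁ w], he, by rw [hTe]; ring⟩
    have h1 := hrel 1 0 e 1 0 e hc hc one_pos
    rw [inner_self_eq_norm_sq_to_K, hTe] at h1
    have h2 : (‖e‖ : ℂ) ≠ 0 := by simpa using he
    have h3 : (α + a) * (‖e‖ : ℂ) ^ 2 = 0 := by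
      simpa using h1
    have h4 := (mul_eq_zero.1 h3).resolve_right (pow_ne_zero 2 h2)
    linear_combination h4
  set β : ℂ := b / α with hβ
  -- The first-order condition at u₁ replaces t₁⟨T₂u₂, T₂u₁⟩ by ⟨u₂, u₁⟩ − s₁⟨T₁u₂, T₁u₁⟩, which
  -- eliminates T₂ and t₁.
  have hrel' : ∀ s₁ t₁ u₁ s₂ t₂ u₂, IsContact T₁ T₂ s₁ t₁ u₁ → IsContact T₁ T₂ s₂ t₂ u₂ →
      0 < s₁ → (1 - s₂ - β * s₁) * inner ℂ (T₁ u₂) (T₁ u₁) + β * inner ℂ u₂ u₁ = 0 := by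
    intro s₁ t₁ u₁ s₂ t₂ u₂ h₁ h₂ hs
    have h3 := hrel s₁ t₁ u₁ s₂ t₂ u₂ h₁ h₂ hs
    rw [← h₁.inner_eq u₂]
    have hb : b = β * α := by rw [hβ, div_mul_cancel₀ _ hα]
    rw [haα, hb] at h3
    refine (mul_eq_zero.1 (?_ : α * _ = 0)).resolve_left hα
    linear_combination h3
  choose! t u hc using fun (s : ℝ) (hs : 0 ≤ s ∧ s ≤ 1) =>
    exists_isContact (T₁ := T₁) (T₂ := T₂) hT₁ hT₂ hs.1 hs.2
  have hdiag : ∀ s, 0 < s → s < 1 →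
      β * ((‖u s‖ ^ 2 - s * ‖T₁ (u s)‖ ^ 2 : ℝ) : ℂ) = ((-(1 - s) * ‖T₁ (u s)‖ ^ 2 : ℝ) : ℂ) := by
    intro s hs0 hs1
    have h1 := hrel' s _ _ s _ _ (hc s ⟨hs0.le, hs1.le⟩) (hc s ⟨hs0.le, hs1.le⟩) hs0
    rw [inner_self_eq_norm_sq_to_K, inner_self_eq_norm_sq_to_K] at h1
    push_cast
    simp only [Complex.coe_algebraMap] at h1
    linear_combination h1
  have hdpos : ∀ s, 0 < s → s < 1 → 0 < ‖u s‖ ^ 2 - s * ‖T₁ (u s)‖ ^ 2 := by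
    intro s hs0 hs1
    have h1 : 0 < ‖u s‖ ^ 2 := by have := (hc s ⟨hs0.le, hs1.le⟩).ne_zero; positivity
    nlinarith [hle₁ (u s)]
  -- The diagonal relation at one interior weight already makes β real and nonpositive; the choice s
  -- = 1/2 is arbitrary.
  obtain ⟨r, hr, hr0⟩ : ∃ r : ℝ, β = r ∧ r ≤ 0 := by
    have h0 : (0 : ℝ) < 1 / 2 := by norm_num
    have h1 : (1 / 2 : ℝ) < 1 := by norm_num
    have hp := hdpos _ h0 h1
    refine ⟨(-(1 - 1 / 2) * ‖T₁ (u (1 / 2))‖ ^ 2) / (‖u (1 / 2)‖ ^ 2 - 1 / 2 * ‖T₁ (u (1 / 2))‖ ^ 2),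
      ?_, ?_⟩
    · rw [Complex.ofReal_div, eq_div_iff (by exact_mod_cast hp.ne')]
      exact hdiag _ h0 h1
    · refine div_nonpos_of_nonpos_of_nonneg ?_ hp.le
      nlinarith [sq_nonneg ‖T₁ (u (1 / 2))‖]
  have horth : ∀ s₁ s₂, 0 < s₁ → s₁ < 1 → 0 < s₂ → s₂ < 1 → s₁ ≠ s₂ →
      (r : ℂ) * inner ℂ (u s₂) (u s₁) = 0 := by
    intro s₁ s₂ h10 h11 h20 h21 hs
    have h1 := hrel' s₁ _ _ s₂ _ _ (hc s₁ ⟨h10.le, h11.le⟩) (hc s₂ ⟨h20.le, h21.le⟩) h10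
    have h2 := congrArg (starRingEnd ℂ)
      (hrel' s₂ _ _ s₁ _ _ (hc s₂ ⟨h20.le, h21.le⟩) (hc s₁ ⟨h10.le, h11.le⟩) h20)
    rw [hr] at h1 h2
    simp only [map_add, map_mul, map_sub, Complex.conj_ofReal, inner_conj_symm, map_zero,
      map_one] at h2
    -- Since β is real, exchanging the two points and conjugating gives a second relation with the
    -- same ⟨u₂, u₁⟩ term. The difference contains only the T₁ term, and 1 − r ≥ 1.
    have h3 : ((s₁ - s₂) * (1 - r) : ℝ) * inner ℂ (T₁ (u s₂)) (T₁ (u s₁)) = 0 := by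
      push_cast
      linear_combination h1 - h2
    have h4 : (((s₁ - s₂) * (1 - r) : ℝ) : ℂ) ≠ 0 := by
      refine Complex.ofReal_ne_zero.2 (mul_ne_zero (sub_ne_zero.2 hs) ?_)
      linarith
    rw [(mul_eq_zero.1 h3).resolve_left h4] at h1
    simpa using h1
  rcases hr0.lt_or_eq with hrneg | rfl
  -- If β < 0, contact vectors at distinct weights are orthogonal. The weights 1/(i + 2) are
  -- distinct points of (0, 1), which contradicts finite dimension.
  · let w : ℕ → H := fun i => u (1 / ((i : ℝ) + 2))
    have hpos : ∀ i : ℕ, (0 : ℝ) < 1 / ((i : ℝ) + 2) := fun i => by positivity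
    have hlt : ∀ i : ℕ, 1 / ((i : ℝ) + 2) < 1 := fun i => by
      rw [div_lt_one (by positivity)]
      have := Nat.cast_nonneg (α := ℝ) i
      linarith
    have hli : LinearIndependent ℂ w := by
      refine linearIndependent_of_ne_zero_of_inner_eq_zero
        (fun i => (hc _ ⟨(hpos i).le, (hlt i).le⟩).ne_zero) fun i j hij => ?_
      refine (mul_eq_zero.1 (horth _ _ (hpos j) (hlt j) (hpos i) (hlt i) ?_)).resolve_left
        (by exact_mod_cast hrneg.ne)
      intro h
      rw [one_div, one_div, inv_inj] at h
      apply hij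
      have : (j : ℝ) = i := by linarith
      exact_mod_cast this.symm
    have := hli.finite
    exact not_finite ℕ
  -- If β = 0, the diagonal relation gives T₁u = 0. Equality at u then reads t‖T₂u‖² = ‖u‖², so t ≥
  -- 1; letting s → 1 contradicts `hne`.
  · have hall : ∀ s, 0 < s → s < 1 → ∀ w, s * ‖T₁ w‖ ^ 2 + ‖T₂ w‖ ^ 2 ≤ ‖w‖ ^ 2 := by
      intro s hs0 hs1
      have h1 := hdiag s hs0 hs1
      rw [hr] at h1
      have h2 : ‖T₁ (u s)‖ ^ 2 = 0 := by
        have h3 : -(1 - s) * ‖T₁ (u s)‖ ^ 2 = 0 := by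
          have := h1.symm
          simp only [Complex.ofReal_zero, zero_mul] at this
          exact_mod_cast this
        exact (mul_eq_zero.1 h3).resolve_left (by linarith)
      have hcs := hc s ⟨hs0.le, hs1.le⟩
      have h4 := hcs.eq
      rw [h2, mul_zero, zero_add] at h4
      have h5 : 0 < ‖u s‖ ^ 2 := by have := hcs.ne_zero; positivity
      have h6 : 1 ≤ t s := by
        by_contra! hlt
        have h7 := mul_le_mul_of_nonneg_left (hle₂ (u s)) hcs.t_nonneg
        have h8 := mul_lt_mul_of_pos_right hlt h5
        linarith
      intro w
      nlinarith [hcs.le w, sq_nonneg ‖T₂ w‖]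
    obtain ⟨w, hw⟩ := hne
    have hlim : Tendsto (fun s : ℝ => s * ‖T₁ w‖ ^ 2 + ‖T₂ w‖ ^ 2) (𝓝[<] 1)
        (𝓝 (1 * ‖T₁ w‖ ^ 2 + ‖T₂ w‖ ^ 2)) :=
      ((by fun_prop : Continuous fun s : ℝ => s * ‖T₁ w‖ ^ 2 + ‖T₂ w‖ ^ 2).tendsto 1).mono_left
        nhdsWithin_le_nhds
    have := le_of_tendsto hlim (b := ‖w‖ ^ 2) (by
      filter_upwards [Ioo_mem_nhdsLT (zero_lt_one' ℝ)] with s hs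
      exact hall s hs.1 hs.2 w)
    linarith

end Contact

/-! ### The pencil of E and its Schur complement -/

noncomputable section

/-- A matrix as a continuous linear map between Euclidean spaces. -/
def euclideanMap {p q : ℕ} (C : Matrix (Fin p) (Fin q) ℂ) :
    EuclideanSpace ℂ (Fin q) →L[ℂ] EuclideanSpace ℂ (Fin p) :=
  (Matrix.toEuclideanLin ≪≫ₗ LinearMap.toContinuousLinearMap) C

theorem norm_euclideanMap {p q : ℕ} (C : Matrix (Fin p) (Fin q) ℂ) : ‖euclideanMap C‖ = ‖C‖ := by
  rw [Matrix.l2_opNorm_def]; rfl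

theorem euclideanMap_apply {p q : ℕ} (C : Matrix (Fin p) (Fin q) ℂ)
    (x : EuclideanSpace ℂ (Fin q)) (i : Fin p) : euclideanMap C x i = ∑ j, C i j * x j := by
  simp [euclideanMap, Matrix.toLpLin_apply, Matrix.mulVec, dotProduct]

/-- The quadratic form `V ↦ ‖(T₁ ⊗ X₁) V‖² + ‖(T₂ ⊗ X₂ᴴ) V‖²`. -/
def blockForm {H K₁ K₂ : Type*} [NormedAddCommGroup H] [InnerProductSpace ℂ H]
    [NormedAddCommGroup K₁] [InnerProductSpace ℂ K₁] [NormedAddCommGroup K₂]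
    [InnerProductSpace ℂ K₂] (T₁ : H →L[ℂ] K₁) (T₂ : H →L[ℂ] K₂) {n : ℕ} (X : MatTuple 2 n)
    (V : Fin n → H) : ℝ :=
  ∑ a, ‖∑ b, X 0 a b • T₁ (V b)‖ ^ 2 + ∑ a, ‖∑ b, star (X 1 b a) • T₂ (V b)‖ ^ 2

section Pencil

variable {k m l n : ℕ} (C₁ : Matrix (Fin k) (Fin m) ℂ) (C₂ : Matrix (Fin m) (Fin l) ℂ)
  (X : MatTuple 2 n)

theorem star_dotProduct_linPart_pairE (w : (Fin k ⊕ (Fin m ⊕ Fin l)) × Fin n → ℂ) :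
    star w ⬝ᵥ (linPart (pairE C₁ C₂) X *ᵥ w)
      = ∑ a, inner ℂ (WithLp.toLp 2 fun i => w (.inl i, a) : EuclideanSpace ℂ (Fin k))
          (∑ b, X 0 a b • euclideanMap C₁ (WithLp.toLp 2 fun i => w (.inr (.inl i), b)))
        + ∑ a, inner ℂ
          (∑ b, star (X 1 b a) • euclideanMap C₂ᴴ (WithLp.toLp 2 fun i => w (.inr (.inl i), b)))
          (WithLp.toLp 2 fun i => w (.inr (.inr i), a) : EuclideanSpace ℂ (Fin l)) := by
  simp only [dotProduct, Matrix.mulVec, Fintype.sum_prod_type, Fintype.sum_sum_type, linPart,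
    Fin.sum_univ_two, pairE, Matrix.add_apply, Matrix.kroneckerMap_apply, Matrix.cons_val_zero,
    Matrix.cons_val_one, Matrix.fromBlocks_apply₁₁, Matrix.fromBlocks_apply₁₂,
    Matrix.fromBlocks_apply₂₁, Matrix.fromBlocks_apply₂₂, Matrix.zero_apply, zero_mul, zero_add,
    add_zero, Finset.sum_const_zero, Matrix.fromCols_apply_inl, Matrix.fromCols_apply_inr,
    Pi.star_apply, mul_zero, PiLp.inner_apply]
  congr 1
  · rw [Finset.sum_comm]
    refine Finset.sum_congr rfl fun a _ => Finset.sum_congr rfl fun i _ => ?_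
    simp only [WithLp.ofLp_sum, Finset.sum_apply, PiLp.smul_apply, euclideanMap_apply, smul_eq_mul,
      Finset.mul_sum, RCLike.inner_apply, Finset.sum_mul]
    rw [Finset.sum_comm]
    refine Finset.sum_congr rfl fun b _ => Finset.sum_congr rfl fun j _ => ?_
    rw [RCLike.star_def]; ring
  · simp only [WithLp.ofLp_sum, Finset.sum_apply, PiLp.smul_apply, euclideanMap_apply, smul_eq_mul,
      Finset.mul_sum, RCLike.inner_apply, map_sum, map_mul,
      Matrix.conjTranspose_apply, RCLike.star_def, Complex.conj_conj]
    have hcomm : ∀ g : Fin m → Fin n → Fin l → Fin n → ℂ,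
        ∑ j, ∑ b, ∑ i, ∑ a, g j b i a = ∑ a, ∑ i, ∑ b, ∑ j, g j b i a := by
      intro g
      rw [← Fintype.sum_prod_type' (f := fun j b => ∑ i, ∑ a, g j b i a)]
      simp_rw [← Fintype.sum_prod_type' (f := fun i a => g _ _ i a)]
      rw [Finset.sum_comm]
      simp_rw [Fintype.sum_prod_type]
      rw [Finset.sum_comm]
      refine Finset.sum_congr rfl fun a _ => Finset.sum_congr rfl fun i _ => Finset.sum_comm
    rw [hcomm]
    refine Finset.sum_congr rfl fun a _ => Finset.sum_congr rfl fun i _ =>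
      Finset.sum_congr rfl fun b _ => Finset.sum_congr rfl fun j _ => ?_
    ring

theorem pencil_isHermitian {ι : Type*} [DecidableEq ι] {g n : ℕ} (A : Fin g → Matrix ι ι ℂ)
    (X : MatTuple g n) : (pencil A X).IsHermitian := by
  unfold Matrix.IsHermitian pencil
  rw [Matrix.conjTranspose_sub, Matrix.conjTranspose_sub, Matrix.conjTranspose_conjTranspose,
    Matrix.conjTranspose_one]
  abel

theorem star_dotProduct_pencil {ι : Type*} [Fintype ι] [DecidableEq ι] {g n : ℕ}
    (A : Fin g → Matrix ι ι ℂ) (X : MatTuple g n) (w : ι × Fin n → ℂ) :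
    star w ⬝ᵥ (pencil A X *ᵥ w)
      = ((∑ p, ‖w p‖ ^ 2 - 2 * (star w ⬝ᵥ (linPart A X *ᵥ w)).re : ℝ) : ℂ) := by
  have h1 : star w ⬝ᵥ ((linPart A X)ᴴ *ᵥ w)
      = (starRingEnd ℂ) (star w ⬝ᵥ (linPart A X *ᵥ w)) := by
    rw [← RCLike.star_def, ← Matrix.star_dotProduct_star, star_star, Matrix.star_mulVec,
      ← Matrix.dotProduct_mulVec]
  have h2 : star w ⬝ᵥ w = ((∑ p, ‖w p‖ ^ 2 : ℝ) : ℂ) := by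
    simp [dotProduct, Complex.conj_mul']
  rw [pencil, Matrix.sub_mulVec, Matrix.sub_mulVec, Matrix.one_mulVec, dotProduct_sub,
    dotProduct_sub, h1, h2, sub_sub, Complex.add_conj]
  push_cast
  ring

/-- Completing the square in the two outer block components, each of which is coupled only to the
middle one. -/
theorem star_dotProduct_pencil_pairE (w : (Fin k ⊕ (Fin m ⊕ Fin l)) × Fin n → ℂ) :
    star w ⬝ᵥ (pencil (pairE C₁ C₂) X *ᵥ w)
      = ((∑ a, ‖(WithLp.toLp 2 fun i => w (.inl i, a) : EuclideanSpace ℂ (Fin k))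
            - ∑ b, X 0 a b • euclideanMap C₁ (WithLp.toLp 2 fun i => w (.inr (.inl i), b))‖ ^ 2
        + ∑ a, ‖(WithLp.toLp 2 fun i => w (.inr (.inr i), a) : EuclideanSpace ℂ (Fin l))
            - ∑ b, star (X 1 b a) •
              euclideanMap C₂ᴴ (WithLp.toLp 2 fun i => w (.inr (.inl i), b))‖ ^ 2
        + (∑ a, ‖(WithLp.toLp 2 fun i => w (.inr (.inl i), a) : EuclideanSpace ℂ (Fin m))‖ ^ 2
          - blockForm (euclideanMap C₁) (euclideanMap C₂ᴴ) X
            fun a => WithLp.toLp 2 fun i => w (.inr (.inl i), a)) : ℝ) : ℂ) := by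
  rw [star_dotProduct_pencil, star_dotProduct_linPart_pairE, Complex.ofReal_inj]
  have h : ∑ p, ‖w p‖ ^ 2
      = ∑ a, ‖(WithLp.toLp 2 fun i => w (.inl i, a) : EuclideanSpace ℂ (Fin k))‖ ^ 2
        + ∑ a, ‖(WithLp.toLp 2 fun i => w (.inr (.inr i), a) : EuclideanSpace ℂ (Fin l))‖ ^ 2
        + ∑ a, ‖(WithLp.toLp 2 fun i => w (.inr (.inl i), a) : EuclideanSpace ℂ (Fin m))‖ ^ 2 := by
    simp only [EuclideanSpace.norm_sq_eq, Fintype.sum_prod_type_right, Fintype.sum_sum_type,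
      Finset.sum_add_distrib]
    ring
  rw [h, blockForm]
  simp only [norm_sub_sq (𝕜 := ℂ), Finset.sum_add_distrib, Finset.sum_sub_distrib, Complex.add_re,
    Complex.re_sum, ← Finset.mul_sum]
  have hre : ∀ x y : EuclideanSpace ℂ (Fin l), (inner ℂ x y).re = RCLike.re (inner ℂ y x) :=
    fun x y => inner_re_symm (𝕜 := ℂ) x y
  have hre' : ∀ x y : EuclideanSpace ℂ (Fin k), (inner ℂ x y).re = RCLike.re (inner ℂ x y) :=
    fun x y => rfl
  simp only [hre, hre']
  ring

theorem mem_freeSpectrahedronInt_pairE :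
    X ∈ freeSpectrahedronInt (pairE C₁ C₂) n ↔ ∀ V : Fin n → EuclideanSpace ℂ (Fin m), V ≠ 0 →
      blockForm (euclideanMap C₁) (euclideanMap C₂ᴴ) X V < ∑ b, ‖V b‖ ^ 2 := by
  change (pencil (pairE C₁ C₂) X).PosDef ↔ _
  rw [Matrix.posDef_iff_dotProduct_mulVec]
  constructor
  · rintro ⟨-, h⟩ V hV
    -- The outer components are chosen to make both completed squares vanish.
    let w : (Fin k ⊕ (Fin m ⊕ Fin l)) × Fin n → ℂ := fun p => Sum.elim
      (fun i => (∑ b, X 0 p.2 b • euclideanMap C₁ (V b)) i)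
      (Sum.elim (fun i => V p.2 i) (fun i => (∑ b, star (X 1 b p.2) • euclideanMap C₂ᴴ (V b)) i))
      p.1
    have hw : w ≠ 0 := by
      obtain ⟨a, ha⟩ := Function.ne_iff.1 hV
      intro h0
      apply ha
      ext i
      exact congrFun h0 (.inr (.inl i), a)
    have h1 := h hw
    rw [star_dotProduct_pencil_pairE] at h1
    have h2 : ∀ a, (WithLp.toLp 2 fun i => w (.inl i, a) : EuclideanSpace ℂ (Fin k))
        = ∑ b, X 0 a b • euclideanMap C₁ (V b) := fun a => rfl
    have h3 : ∀ a, (WithLp.toLp 2 fun i => w (.inr (.inl i), a) : EuclideanSpace ℂ (Fin m))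
        = V a := fun a => rfl
    have h4 : ∀ a, (WithLp.toLp 2 fun i => w (.inr (.inr i), a) : EuclideanSpace ℂ (Fin l))
        = ∑ b, star (X 1 b a) • euclideanMap C₂ᴴ (V b) := fun a => rfl
    simp only [h2, h3, h4, sub_self, norm_zero] at h1
    have h5 := Complex.zero_lt_real.1 h1
    simpa using h5
  · refine fun h => ⟨pencil_isHermitian _ _, fun w hw => ?_⟩
    rw [star_dotProduct_pencil_pairE, Complex.zero_lt_real]
    rcases eq_or_ne (fun a => (WithLp.toLp 2 fun i => w (.inr (.inl i), a) :
      EuclideanSpace ℂ (Fin m))) 0 with hV | hV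
    · have hV' : ∀ a, (WithLp.toLp 2 fun i => w (.inr (.inl i), a) : EuclideanSpace ℂ (Fin m))
        = 0 := fun a => congrFun hV a
      simp only [hV', blockForm, map_zero, smul_zero, Finset.sum_const_zero, sub_zero, norm_zero,
        ne_eq, OfNat.ofNat_ne_zero, not_false_eq_true, zero_pow, add_zero]
      by_contra! hneg
      apply hw
      have hz1 : ∑ a, ‖(WithLp.toLp 2 fun i => w (.inl i, a) : EuclideanSpace ℂ (Fin k))‖ ^ 2 = 0 :=
        le_antisymm (by
          have : 0 ≤ ∑ a, ‖(WithLp.toLp 2 fun i => w (.inr (.inr i), a) :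
            EuclideanSpace ℂ (Fin l))‖ ^ 2 := by positivity
          linarith) (by positivity)
      have hz2 : ∑ a, ‖(WithLp.toLp 2 fun i => w (.inr (.inr i), a) :
          EuclideanSpace ℂ (Fin l))‖ ^ 2 = 0 := le_antisymm (by linarith) (by positivity)
      rw [Finset.sum_eq_zero_iff_of_nonneg (fun _ _ => by positivity)] at hz1 hz2
      ext ⟨i | i | i, a⟩
      · have := hz1 a (Finset.mem_univ a)
        rw [sq_eq_zero_iff, norm_eq_zero] at this
        exact congrArg (fun x : EuclideanSpace ℂ (Fin k) => x i) this
      · exact congrArg (fun x : EuclideanSpace ℂ (Fin m) => x i) (hV' a)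
      · have := hz2 a (Finset.mem_univ a)
        rw [sq_eq_zero_iff, norm_eq_zero] at this
        exact congrArg (fun x : EuclideanSpace ℂ (Fin l) => x i) this
    · have h1 := h _ hV
      have h2 : ∀ {p : ℕ} (x : Fin n → EuclideanSpace ℂ (Fin p)), 0 ≤ ∑ a, ‖x a‖ ^ 2 :=
        fun x => by positivity
      have h3 := h2 fun a => (WithLp.toLp 2 fun i => w (.inl i, a) : EuclideanSpace ℂ (Fin k))
            - ∑ b, X 0 a b • euclideanMap C₁ (WithLp.toLp 2 fun i => w (.inr (.inl i), b))
      have h4 := h2 fun a => (WithLp.toLp 2 fun i => w (.inr (.inr i), a) :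
        EuclideanSpace ℂ (Fin l)) - ∑ b, star (X 1 b a) •
              euclideanMap C₂ᴴ (WithLp.toLp 2 fun i => w (.inr (.inl i), b))
      linarith

end Pencil
end

/-! ### Geometry of the domains: convexity, circularity, boundedness -/

section Domain

open Metric Set Filter Topology

theorem linPart_smul {ι : Type*} {g n : ℕ} (A : Fin g → Matrix ι ι ℂ) (c : ℂ) (X : MatTuple g n) :
    linPart A (c • X) = c • linPart A X := by
  simp [linPart, Finset.smul_sum, Matrix.kronecker_smul]

theorem linPart_add {ι : Type*} {g n : ℕ} (A : Fin g → Matrix ι ι ℂ) (X Y : MatTuple g n) :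
    linPart A (X + Y) = linPart A X + linPart A Y := by
  simp [linPart, Matrix.kronecker_add, Finset.sum_add_distrib]

theorem pencil_combination {ι : Type*} [DecidableEq ι] {g n : ℕ} (A : Fin g → Matrix ι ι ℂ)
    (X Y : MatTuple g n) {a b : ℝ} (hab : a + b = 1) :
    pencil A ((a : ℂ) • X + (b : ℂ) • Y) = (a : ℂ) • pencil A X + (b : ℂ) • pencil A Y := by
  have h : (1 : Matrix (ι × Fin n) (ι × Fin n) ℂ) = (a : ℂ) • 1 + (b : ℂ) • 1 := by
    rw [← add_smul, ← Complex.ofReal_add, hab, Complex.ofReal_one, one_smul]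
  simp only [pencil, linPart_add, linPart_smul, Matrix.conjTranspose_add,
    Matrix.conjTranspose_smul, RCLike.star_def, Complex.conj_ofReal, smul_sub]
  nth_rewrite 1 [h]
  abel

theorem zero_mem_freeSpectrahedronInt {ι : Type*} [Fintype ι] [DecidableEq ι] {g n : ℕ}
    (A : Fin g → Matrix ι ι ℂ) : (0 : MatTuple g n) ∈ freeSpectrahedronInt A n := by
  change (pencil A 0).PosDef
  simpa [pencil, linPart] using Matrix.PosDef.one

theorem convex_freeSpectrahedronInt {ι : Type*} [Fintype ι] [DecidableEq ι] {g n : ℕ}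
    (A : Fin g → Matrix ι ι ℂ) : Convex ℝ (freeSpectrahedronInt A n) := by
  rw [convex_iff_forall_pos]
  intro X hX Y hY a b ha hb hab
  change (pencil A _).PosDef
  have := pencil_combination A X Y hab
  simp only [Complex.coe_smul] at this
  rw [this]
  exact (Matrix.PosDef.smul hX ha).add (Matrix.PosDef.smul hY hb)

theorem Matrix.PosDef.exists_sub_smul_one_posSemidef {ι : Type*} [Fintype ι] [DecidableEq ι]
    {M : Matrix ι ι ℂ} (hM : M.PosDef) : ∃ δ : ℝ, 0 < δ ∧ (M - (δ : ℂ) • 1).PosSemidef := by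
  obtain ⟨δ, hδ, h⟩ := exists_pos_le_of_sphere (H := EuclideanSpace ℂ ι)
    (q := fun w => (star w.ofLp ⬝ᵥ (M *ᵥ w.ofLp)).re)
    (by
      simp only [dotProduct, Matrix.mulVec]
      fun_prop)
    (fun c w => by
      have : star (c • w).ofLp ⬝ᵥ (M *ᵥ (c • w).ofLp)
          = ((‖c‖ ^ 2 : ℝ) : ℂ) * (star w.ofLp ⬝ᵥ (M *ᵥ w.ofLp)) := by
        rw [WithLp.ofLp_smul, Matrix.mulVec_smul, dotProduct_smul, star_smul, smul_dotProduct,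
          smul_eq_mul, smul_eq_mul, ← mul_assoc, RCLike.star_def, Complex.mul_conj']
        push_cast; rfl
      rw [this, Complex.re_ofReal_mul])
    (fun w hw => by
      have := hM.dotProduct_mulVec_pos (x := w.ofLp) (by simpa using hw)
      exact (Complex.lt_def.1 this).1)
  refine ⟨δ, hδ, Matrix.PosSemidef.of_dotProduct_mulVec_nonneg ?_ fun w => ?_⟩
  · refine hM.1.sub ?_
    unfold Matrix.IsHermitian
    simp
  · have h1 := h (WithLp.toLp 2 w)
    have h2 : star w ⬝ᵥ w = ((∑ p, ‖w p‖ ^ 2 : ℝ) : ℂ) := by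
      simp [dotProduct, Complex.conj_mul']
    rw [Matrix.sub_mulVec, Matrix.smul_mulVec, Matrix.one_mulVec, dotProduct_sub,
      dotProduct_smul, h2]
    rw [EuclideanSpace.norm_sq_eq] at h1
    have h3 : star w ⬝ᵥ (M *ᵥ w) = (((star w ⬝ᵥ (M *ᵥ w)).re : ℝ) : ℂ) := by
      refine Complex.ext (by simp) ?_
      have := hM.1.im_star_dotProduct_mulVec_self w
      simpa using this
    rw [h3, smul_eq_mul, ← Complex.ofReal_mul, ← Complex.ofReal_sub, Complex.zero_le_real]
    simpa using h1

/-- Circularity is assumed for the closed set only. A positive definite pencil leaves room to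
stretch X by 1 + δ; the stretched tuple is rotated inside the closed set, and shrinking it back
restores strict positivity. -/
theorem smul_mem_freeSpectrahedronInt_of_isCircular {ι : Type*} [Fintype ι] [DecidableEq ι]
    {g n : ℕ} {A : Fin g → Matrix ι ι ℂ} (hA : IsCircular (freeSpectrahedron A))
    {X : MatTuple g n} (hX : X ∈ freeSpectrahedronInt A n) {γ : ℂ} (hγ : ‖γ‖ = 1) :
    γ • X ∈ freeSpectrahedronInt A n := by
  obtain ⟨δ, hδ, hpos⟩ := Matrix.PosDef.exists_sub_smul_one_posSemidef (M := pencil A X) hX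
  have h0 : pencil A (0 : MatTuple g n) = 1 := by simp [pencil, linPart]
  have h1 : ((1 + δ : ℝ) : ℂ) • X ∈ freeSpectrahedron A n := by
    change (pencil A _).PosSemidef
    have h2 := pencil_combination A X 0 (a := 1 + δ) (b := -δ) (by ring)
    rw [smul_zero, add_zero, h0] at h2
    rw [h2]
    have h3 : ((1 + δ : ℝ) : ℂ) • pencil A X + ((-δ : ℝ) : ℂ) • (1 : Matrix (ι × Fin n) _ ℂ)
        = δ • pencil A X + (pencil A X - (δ : ℂ) • 1) := by
      push_cast
      rw [add_smul, one_smul, neg_smul, Complex.coe_smul]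
      abel
    rw [h3]
    exact (Matrix.PosSemidef.smul (Matrix.PosDef.posSemidef hX) hδ.le).add hpos
  have h2 := hA n _ h1 γ hγ
  change (pencil A _).PosDef
  have h4 := pencil_combination A (γ • ((1 + δ : ℝ) : ℂ) • X) 0 (a := (1 + δ)⁻¹)
    (b := δ * (1 + δ)⁻¹) (by field_simp)
  have hne : ((1 + δ : ℝ) : ℂ) ≠ 0 := Complex.ofReal_ne_zero.2 (by positivity)
  have h5 : ((((1 + δ)⁻¹ : ℝ)) : ℂ) • γ • ((1 + δ : ℝ) : ℂ) • X = γ • X := by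
    rw [smul_comm, Complex.ofReal_inv, inv_smul_smul₀ hne]
  rw [smul_zero, add_zero, h0, h5] at h4
  rw [h4, Complex.coe_smul, Complex.coe_smul, add_comm]
  exact (Matrix.PosDef.one.smul (by positivity)).add_posSemidef
    (Matrix.PosSemidef.smul h2 (by positivity))

variable {k m l n : ℕ} {C₁ : Matrix (Fin k) (Fin m) ℂ} {C₂ : Matrix (Fin m) (Fin l) ℂ}

theorem smul_mem_freeSpectrahedronInt_pairE {X : MatTuple 2 n}
    (hX : X ∈ freeSpectrahedronInt (pairE C₁ C₂) n) {z : ℂ} (hz : ‖z‖ ≤ 1) :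
    z • X ∈ freeSpectrahedronInt (pairE C₁ C₂) n := by
  rw [mem_freeSpectrahedronInt_pairE] at *
  intro V hV
  have h1 : blockForm (euclideanMap C₁) (euclideanMap C₂ᴴ) (z • X) V
      = ‖z‖ ^ 2 * blockForm (euclideanMap C₁) (euclideanMap C₂ᴴ) X V := by
    simp only [blockForm, Pi.smul_apply, Matrix.smul_apply, smul_eq_mul, mul_smul, star_mul',
      ← Finset.smul_sum, norm_smul, mul_pow, ← Finset.mul_sum, norm_star]
    ring
  have h2 : 0 ≤ blockForm (euclideanMap C₁) (euclideanMap C₂ᴴ) X V := by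
    unfold blockForm; positivity
  rw [h1]
  have h3 : ‖z‖ ^ 2 ≤ 1 := pow_le_one₀ (norm_nonneg _) hz
  nlinarith [hX V hV]

theorem norm_euclideanMap_apply_sq {p q : ℕ} (C : Matrix (Fin p) (Fin q) ℂ)
    (x : EuclideanSpace ℂ (Fin q)) : ‖euclideanMap C x‖ ^ 2 = ∑ i, ‖∑ j, C i j * x j‖ ^ 2 := by
  simp [EuclideanSpace.norm_sq_eq, euclideanMap_apply]

theorem sum_norm_sq_le_opNorm {p q r : ℕ} (M : Matrix (Fin p) (Fin q) ℂ)
    (w : Fin q → EuclideanSpace ℂ (Fin r)) :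
    ∑ a, ‖∑ b, M a b • w b‖ ^ 2 ≤ ‖M‖ ^ 2 * ∑ b, ‖w b‖ ^ 2 := by
  simp only [EuclideanSpace.norm_sq_eq, WithLp.ofLp_sum, Finset.sum_apply, PiLp.smul_apply,
    smul_eq_mul]
  rw [Finset.sum_comm, Finset.sum_comm (s := (Finset.univ : Finset (Fin q))), Finset.mul_sum]
  refine Finset.sum_le_sum fun i _ => ?_
  have h1 := (euclideanMap M).le_opNorm (WithLp.toLp 2 fun b => w b i)
  rw [norm_euclideanMap] at h1
  have h2 : ‖euclideanMap M (WithLp.toLp 2 fun b => w b i)‖ ^ 2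
      ≤ (‖M‖ * ‖(WithLp.toLp 2 fun b => w b i : EuclideanSpace ℂ (Fin q))‖) ^ 2 := by gcongr
  rw [norm_euclideanMap_apply_sq, mul_pow, EuclideanSpace.norm_sq_eq] at h2
  exact h2

/-- Test the form on product vectors x ⊗ e, where e is a vector at which C₁ (or C₂ᴴ) attains its
norm. -/
theorem norm_lt_one_of_mem_pairE (hC₁ : ‖C₁‖ = 1) (hC₂ : ‖C₂‖ = 1) {X : MatTuple 2 n}
    (hX : X ∈ freeSpectrahedronInt (pairE C₁ C₂) n) (j : Fin 2) : ‖X j‖ < 1 := by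
  rw [mem_freeSpectrahedronInt_pairE] at hX
  have hV : ∀ (e : EuclideanSpace ℂ (Fin m)) (x : EuclideanSpace ℂ (Fin n)), e ≠ 0 → x ≠ 0 →
      blockForm (euclideanMap C₁) (euclideanMap C₂ᴴ) X (fun b => x b • e)
        < ‖x‖ ^ 2 * ‖e‖ ^ 2 := by
    intro e x he hx
    have h1 := hX (fun b => x b • e) (fun h => hx (by
      ext b
      exact (smul_eq_zero.1 (congrFun h b)).resolve_right he))
    simpa [norm_smul, mul_pow, ← Finset.sum_mul, EuclideanSpace.norm_sq_eq x] using h1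
  have haux : ∀ {p : ℕ} (M : Matrix (Fin n) (Fin n) ℂ) (e : EuclideanSpace ℂ (Fin p))
      (x : EuclideanSpace ℂ (Fin n)),
      ∑ a, ‖∑ b, M a b • x b • e‖ ^ 2 = ‖euclideanMap M x‖ ^ 2 * ‖e‖ ^ 2 := by
    intro p M e x
    simp [smul_smul, ← Finset.sum_smul, norm_smul, mul_pow, ← Finset.sum_mul,
      norm_euclideanMap_apply_sq]
  fin_cases j
  · obtain ⟨e, he, hTe⟩ := exists_norm_eq_of_opNorm_eq_one
      (T₁ := euclideanMap C₁) (by rw [norm_euclideanMap, hC₁])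
    change ‖X 0‖ < 1
    rw [← norm_euclideanMap]
    refine opNorm_lt_one_of_forall_lt fun x hx => ?_
    have h1 := hV e x he hx
    simp only [blockForm, map_smul] at h1
    rw [haux, hTe] at h1
    have h2 : ‖euclideanMap (X 0) x‖ ^ 2 * ‖e‖ ^ 2 < ‖x‖ ^ 2 * ‖e‖ ^ 2 :=
      lt_of_le_of_lt (le_add_of_nonneg_right (by positivity)) h1
    exact lt_of_pow_lt_pow_left₀ 2 (norm_nonneg _)
      (lt_of_mul_lt_mul_right h2 (sq_nonneg _))
  · obtain ⟨e, he, hTe⟩ := exists_norm_eq_of_opNorm_eq_one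
      (T₁ := euclideanMap C₂ᴴ) (by rw [norm_euclideanMap, Matrix.l2_opNorm_conjTranspose, hC₂])
    change ‖X 1‖ < 1
    rw [← Matrix.l2_opNorm_conjTranspose, ← norm_euclideanMap]
    refine opNorm_lt_one_of_forall_lt fun x hx => ?_
    have h1 := hV e x he hx
    simp only [blockForm, map_smul] at h1
    have h3 := haux (X 1)ᴴ (euclideanMap C₂ᴴ e) x
    simp only [Matrix.conjTranspose_apply] at h3
    rw [h3, hTe] at h1
    have h2 : ‖euclideanMap (X 1)ᴴ x‖ ^ 2 * ‖e‖ ^ 2 < ‖x‖ ^ 2 * ‖e‖ ^ 2 :=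
      lt_of_le_of_lt (le_add_of_nonneg_left (by positivity)) h1
    exact lt_of_pow_lt_pow_left₀ 2 (norm_nonneg _)
      (lt_of_mul_lt_mul_right h2 (sq_nonneg _))

theorem norm_le_one_of_mem_pairE (hC₁ : ‖C₁‖ = 1) (hC₂ : ‖C₂‖ = 1) {X : MatTuple 2 n}
    (hX : X ∈ freeSpectrahedronInt (pairE C₁ C₂) n) : ‖X‖ ≤ 1 :=
  (pi_norm_le_iff_of_nonneg zero_le_one).2 fun j => (norm_lt_one_of_mem_pairE hC₁ hC₂ hX j).le

theorem sum_norm_sq_pos {H : Type*} [NormedAddCommGroup H] {V : Fin n → H} (hV : V ≠ 0) :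
    0 < ∑ b, ‖V b‖ ^ 2 := by
  obtain ⟨a, ha⟩ := Function.ne_iff.1 hV
  refine Finset.sum_pos' (fun _ _ => by positivity) ⟨a, Finset.mem_univ a, ?_⟩
  have : V a ≠ 0 := ha
  positivity

theorem freeSpectrahedronInt_pairE_eq_freeBidisk (hC₁ : ‖C₁‖ = 1) (hC₂ : ‖C₂‖ = 1)
    (hle : ∀ w, ‖euclideanMap C₁ w‖ ^ 2 + ‖euclideanMap C₂ᴴ w‖ ^ 2 ≤ ‖w‖ ^ 2) :
    freeSpectrahedronInt (pairE C₁ C₂) = freeBidisk := by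
  funext n
  ext X
  refine ⟨fun hX => norm_lt_one_of_mem_pairE hC₁ hC₂ hX, fun hX => ?_⟩
  have hX' : ∀ j, ‖X j‖ < 1 := hX
  rw [mem_freeSpectrahedronInt_pairE]
  intro V hV
  have hpos := sum_norm_sq_pos hV
  set r := max ‖X 0‖ ‖X 1‖ with hr
  have hr1 : r < 1 := max_lt (hX' 0) (hX' 1)
  have hr0 : 0 ≤ r := (norm_nonneg _).trans (le_max_left _ _)
  have h1 := sum_norm_sq_le_opNorm (X 0) fun b => euclideanMap C₁ (V b)
  have h2 := sum_norm_sq_le_opNorm (X 1)ᴴ fun b => euclideanMap C₂ᴴ (V b)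
  rw [Matrix.l2_opNorm_conjTranspose] at h2
  have h3 : ‖X 0‖ ^ 2 ≤ r ^ 2 := by gcongr; exact le_max_left _ _
  have h4 : ‖X 1‖ ^ 2 ≤ r ^ 2 := by gcongr; exact le_max_right _ _
  have h5 : ∑ b, ‖euclideanMap C₁ (V b)‖ ^ 2 + ∑ b, ‖euclideanMap C₂ᴴ (V b)‖ ^ 2
      ≤ ∑ b, ‖V b‖ ^ 2 := by
    rw [← Finset.sum_add_distrib]
    exact Finset.sum_le_sum fun b _ => hle (V b)
  have h6 : 0 ≤ ∑ b, ‖euclideanMap C₁ (V b)‖ ^ 2 := by positivity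
  have h7 : 0 ≤ ∑ b, ‖euclideanMap C₂ᴴ (V b)‖ ^ 2 := by positivity
  have h8 : r ^ 2 < 1 := by nlinarith
  calc blockForm (euclideanMap C₁) (euclideanMap C₂ᴴ) X V
      ≤ ‖X 0‖ ^ 2 * ∑ b, ‖euclideanMap C₁ (V b)‖ ^ 2
        + ‖X 1‖ ^ 2 * ∑ b, ‖euclideanMap C₂ᴴ (V b)‖ ^ 2 := add_le_add h1 h2
    _ ≤ r ^ 2 * ∑ b, ‖V b‖ ^ 2 := by nlinarith
    _ < ∑ b, ‖V b‖ ^ 2 := by nlinarith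

/-- Tuples with small entries belong to the domain. -/
theorem mem_pairE_of_entries_le (hC₁ : ‖C₁‖ = 1) (hC₂ : ‖C₂‖ = 1) {X : MatTuple 2 n}
    (hX : ∀ j a b, ‖X j a b‖ ≤ 1 / (2 * ((n : ℝ) + 1))) :
    X ∈ freeSpectrahedronInt (pairE C₁ C₂) n := by
  rw [mem_freeSpectrahedronInt_pairE]
  intro V hV
  have hpos := sum_norm_sq_pos hV
  set η : ℝ := 1 / (2 * ((n : ℝ) + 1)) with hη
  have hn : (0 : ℝ) ≤ n := Nat.cast_nonneg n
  have haux : ∀ {p : ℕ} (T : EuclideanSpace ℂ (Fin m) →L[ℂ] EuclideanSpace ℂ (Fin p))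
      (M : Fin n → Fin n → ℂ), ‖T‖ = 1 → (∀ a b, ‖M a b‖ ≤ η) →
      ∑ a, ‖∑ b, M a b • T (V b)‖ ^ 2 ≤ n * (η ^ 2 * (n * ∑ b, ‖V b‖ ^ 2)) := by
    intro p T M hT hM
    have h1 : ∀ a, ‖∑ b, M a b • T (V b)‖ ^ 2 ≤ η ^ 2 * (n * ∑ b, ‖V b‖ ^ 2) := by
      intro a
      have h2 : ‖∑ b, M a b • T (V b)‖ ≤ η * ∑ b, ‖V b‖ := by
        rw [Finset.mul_sum]
        refine norm_sum_le_of_le _ fun b _ => ?_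
        rw [norm_smul]
        refine mul_le_mul (hM a b) ?_ (norm_nonneg _) (by positivity)
        simpa [hT] using T.le_opNorm (V b)
      have h3 : (∑ b, ‖V b‖) ^ 2 ≤ n * ∑ b, ‖V b‖ ^ 2 := by
        simpa using sq_sum_le_card_mul_sum_sq (s := Finset.univ) (f := fun b => ‖V b‖)
      calc ‖∑ b, M a b • T (V b)‖ ^ 2 ≤ (η * ∑ b, ‖V b‖) ^ 2 := by gcongr
        _ = η ^ 2 * (∑ b, ‖V b‖) ^ 2 := by ring
        _ ≤ _ := by gcongr
    refine (Finset.sum_le_sum fun a _ => h1 a).trans (le_of_eq ?_)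
    simp
  have h1 := haux (euclideanMap C₁) (fun a b => X 0 a b) (by rw [norm_euclideanMap, hC₁])
    (fun a b => hX 0 a b)
  have h2 := haux (euclideanMap C₂ᴴ) (fun a b => star (X 1 b a))
    (by rw [norm_euclideanMap, Matrix.l2_opNorm_conjTranspose, hC₂])
    (fun a b => by rw [norm_star]; exact hX 1 b a)
  have h3 : n * η ≤ 1 / 2 := by
    rw [hη, mul_one_div, div_le_div_iff₀ (by positivity) (by norm_num)]
    linarith
  have h4 : 0 ≤ n * η := by positivity
  have h5 : (n * η) ^ 2 ≤ 1 / 4 := by nlinarith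
  calc blockForm (euclideanMap C₁) (euclideanMap C₂ᴴ) X V
      ≤ 2 * ((n * η) ^ 2 * ∑ b, ‖V b‖ ^ 2) := by
        refine (add_le_add h1 h2).trans (le_of_eq ?_)
        ring
    _ < ∑ b, ‖V b‖ ^ 2 := by nlinarith

theorem pairE_mem_nhds_zero (hC₁ : ‖C₁‖ = 1) (hC₂ : ‖C₂‖ = 1) :
    freeSpectrahedronInt (pairE C₁ C₂) n ∈ 𝓝 (0 : MatTuple 2 n) := by
  have h : ∀ᶠ X : MatTuple 2 n in 𝓝 0, ∀ j a b, ‖X j a b‖ ≤ 1 / (2 * ((n : ℝ) + 1)) := by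
    simp only [eventually_all]
    intro j a b
    have hc : Continuous fun X : MatTuple 2 n => ‖X j a b‖ := by fun_prop
    have h1 := (hc.tendsto 0).eventually_lt_const (u := 1 / (2 * ((n : ℝ) + 1)))
      (by simp only [Pi.zero_apply, Matrix.zero_apply, norm_zero]; positivity)
    exact h1.mono fun X hX => hX.le
  filter_upwards [h] with X hX
  exact mem_pairE_of_entries_le hC₁ hC₂ hX

end Domain

/-! ### Weighted shifts -/

noncomputable section

/-- A pair of weighted shifts on `ℂ⁴`. -/
def shiftPair (y₀ x₁ y₁ x₂ : ℂ) : MatTuple 2 4 :=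
  ![!![0, 0, 0, 0; 0, 0, 0, 0; 0, x₁, 0, 0; 0, 0, x₂, 0],
    !![0, 0, 0, 0; y₀, 0, 0, 0; 0, y₁, 0, 0; 0, 0, 0, 0]]

theorem smul_shiftPair (z y₀ x₁ y₁ x₂ : ℂ) :
    z • shiftPair y₀ x₁ y₁ x₂ = shiftPair (z * y₀) (z * x₁) (z * y₁) (z * x₂) := by
  ext j a b
  fin_cases j <;> fin_cases a <;> fin_cases b <;> simp [shiftPair]

theorem shiftPair_eq_sum (y₀ x₁ y₁ x₂ : ℂ) :
    shiftPair y₀ x₁ y₁ x₂ = y₀ • shiftPair 1 0 0 0 + x₁ • shiftPair 0 1 0 0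
      + y₁ • shiftPair 0 0 1 0 + x₂ • shiftPair 0 0 0 1 := by
  ext j a b
  fin_cases j <;> fin_cases a <;> fin_cases b <;> simp [shiftPair]

theorem differentiable_shiftPair {E : Type*} [NormedAddCommGroup E] [NormedSpace ℂ E]
    {y₀ x₁ y₁ x₂ : E → ℂ} (h0 : Differentiable ℂ y₀) (h1 : Differentiable ℂ x₁)
    (h2 : Differentiable ℂ y₁) (h3 : Differentiable ℂ x₂) :
    Differentiable ℂ fun z => shiftPair (y₀ z) (x₁ z) (y₁ z) (x₂ z) := by
  have h : (fun z => shiftPair (y₀ z) (x₁ z) (y₁ z) (x₂ z)) = fun z => y₀ z • shiftPair 1 0 0 0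
      + x₁ z • shiftPair 0 1 0 0 + y₁ z • shiftPair 0 0 1 0 + x₂ z • shiftPair 0 0 0 1 :=
    funext fun z => shiftPair_eq_sum _ _ _ _
  rw [h]
  exact (((h0.smul_const _).add (h1.smul_const _)).add (h2.smul_const _)).add (h3.smul_const _)

theorem tupleConj_diagonal_apply {g n : ℕ} (d : Fin n → ℂ) (X : MatTuple g n) (j : Fin g)
    (a b : Fin n) : tupleConj (Matrix.diagonal d) X j a b = star (d a) * X j a b * d b := by
  simp [tupleConj, Matrix.diagonal_conjTranspose]

/-- The weights x₁ and y₁ sit in the same matrix position (2, 1), so diagonal unitaries can only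
rotate them together. -/
theorem tupleConj_diagonal_shiftPair (d : Fin 4 → ℂ) (y₀ x₁ y₁ x₂ : ℂ) :
    tupleConj (Matrix.diagonal d) (shiftPair y₀ x₁ y₁ x₂)
      = shiftPair (star (d 1) * d 0 * y₀) (star (d 2) * d 1 * x₁) (star (d 2) * d 1 * y₁)
          (star (d 3) * d 2 * x₂) := by
  ext j a b
  rw [tupleConj_diagonal_apply]
  fin_cases j <;> fin_cases a <;> fin_cases b <;> simp [shiftPair, mul_right_comm]

theorem diagonal_mem_unitaryGroup {n : ℕ} {d : Fin n → ℂ} (hd : ∀ a, ‖d a‖ = 1) :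
    Matrix.diagonal d ∈ Matrix.unitaryGroup (Fin n) ℂ := by
  rw [Matrix.mem_unitaryGroup_iff', Matrix.star_eq_conjTranspose, Matrix.diagonal_conjTranspose,
    Matrix.diagonal_mul_diagonal, ← Matrix.diagonal_one]
  congr 1
  funext a
  simp [Complex.conj_mul', hd a]

/-! ### Homogeneity of equivariant maps in the weights -/

section Equivariant

open Metric Set Filter Topology

/-- `G` is holomorphic on `S` and commutes with unitary conjugation. -/
structure IsEquivariantOn {n : ℕ} (S : Set (MatTuple 2 n)) (G : MatTuple 2 n → MatTuple 2 n) :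
    Prop where
  differentiableAt : ∀ X ∈ S, DifferentiableAt ℂ G X
  map_conj : ∀ X ∈ S, ∀ U ∈ Matrix.unitaryGroup (Fin n) ℂ,
    G (tupleConj U X) = tupleConj U (G X)

variable {S : Set (MatTuple 2 4)} {G : MatTuple 2 4 → MatTuple 2 4}

theorem differentiableAt_entry {n : ℕ} {F : ℂ → MatTuple 2 n} {z : ℂ}
    (hF : DifferentiableAt ℂ F z) (j : Fin 2) (a b : Fin n) :
    DifferentiableAt ℂ (fun z => F z j a b) z := by
  let L : MatTuple 2 n →ₗ[ℂ] ℂ :=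
    { toFun := fun X => X j a b, map_add' := fun _ _ => rfl, map_smul' := fun _ _ => rfl }
  exact (LinearMap.toContinuousLinearMap L).differentiableAt.comp z hF

/-- Homogeneity of the entries of an equivariant map at pairs of weighted shifts. -/
theorem IsEquivariantOn.entry_eq (hG : IsEquivariantOn S G) {y₀ x₁ y₁ x₂ : ℂ} (k₀ k₁ k₂ : ℕ)
    (hS : ∀ z : ℂ, ‖z‖ ≤ 1 →
      shiftPair (z ^ k₀ * y₀) (z ^ k₁ * x₁) (z ^ k₁ * y₁) (z ^ k₂ * x₂) ∈ S)
    (j : Fin 2) (a b : Fin 4) (p q : ℕ)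
    (hpq : p + (![0, k₀, k₀ + k₁, k₀ + k₁ + k₂] : Fin 4 → ℕ) a
      = q + (![0, k₀, k₀ + k₁, k₀ + k₁ + k₂] : Fin 4 → ℕ) b) {z : ℂ} (hz : ‖z‖ ≤ 1) :
    z ^ p * G (shiftPair (z ^ k₀ * y₀) (z ^ k₁ * x₁) (z ^ k₁ * y₁) (z ^ k₂ * x₂)) j a b
      = z ^ q * G (shiftPair y₀ x₁ y₁ x₂) j a b := by
  set e : Fin 4 → ℕ := ![0, k₀, k₀ + k₁, k₀ + k₁ + k₂] with he
  let F : ℂ → MatTuple 2 4 := fun z =>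
    shiftPair (z ^ k₀ * y₀) (z ^ k₁ * x₁) (z ^ k₁ * y₁) (z ^ k₂ * x₂)
  have hF : Differentiable ℂ F := differentiable_shiftPair (by fun_prop) (by fun_prop)
    (by fun_prop) (by fun_prop)
  have h1S : shiftPair y₀ x₁ y₁ x₂ ∈ S := by simpa using hS 1 (by simp)
  refine eq_pow_smul_of_circle (G := fun z => z ^ p * G (F z) j a b)
    (c := G (shiftPair y₀ x₁ y₁ x₂) j a b) (k := q) (fun w hw => ?_) (fun w hw => ?_) hz
  · have h1 : DifferentiableAt ℂ (fun z => G (F z)) w :=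
      (hG.differentiableAt _ (hS w hw)).comp w (hF w)
    exact (by fun_prop : DifferentiableAt ℂ (fun z : ℂ => z ^ p) w).mul
      (differentiableAt_entry h1 j a b)
  · have h1 : w * star w = 1 := by simp [Complex.mul_conj', hw]
    have hpow : ∀ p q : ℕ, star (star w ^ (p + q)) * star w ^ p = w ^ q := by
      intro p q
      rw [star_pow, star_star, pow_add, mul_right_comm, ← mul_pow, h1, one_pow, one_mul]
    -- For |w| = 1, scaling the weights is conjugation by a diagonal unitary, which multiplies the
    -- (a, b) entry by w ^ (e a − e b). The exponents p and q keep all powers nonnegative, so the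
    -- identity extends holomorphically into the disc.
    have hFw : F w = tupleConj (Matrix.diagonal fun a => star w ^ e a)
        (shiftPair y₀ x₁ y₁ x₂) := by
      rw [tupleConj_diagonal_shiftPair]
      have h01 := hpow 0 k₀
      rw [zero_add] at h01
      simp only [he, Matrix.cons_val_zero, Matrix.cons_val_one, Matrix.cons_val, h01, hpow, F]
    rw [hFw, hG.map_conj _ h1S _ (diagonal_mem_unitaryGroup fun a => by
      simp [hw]), tupleConj_diagonal_apply, smul_eq_mul, star_pow, star_star]
    calc w ^ p * (w ^ e a * G (shiftPair y₀ x₁ y₁ x₂) j a b * star w ^ e b)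
        = w ^ (p + e a) * star w ^ e b * G (shiftPair y₀ x₁ y₁ x₂) j a b := by ring
      _ = w ^ q * (w * star w) ^ e b * G (shiftPair y₀ x₁ y₁ x₂) j a b := by rw [hpq]; ring
      _ = _ := by rw [h1, one_pow, mul_one]

theorem IsEquivariantOn.entry_smul (hG : IsEquivariantOn S G)
    (hS : ∀ X ∈ S, ∀ z : ℂ, ‖z‖ ≤ 1 → z • X ∈ S) {y₀ x₁ y₁ x₂ : ℂ}
    (hX : shiftPair y₀ x₁ y₁ x₂ ∈ S) (j : Fin 2) (a b : Fin 4) {z : ℂ} (hz : ‖z‖ ≤ 1) :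
    z ^ (b : ℕ) * G (z • shiftPair y₀ x₁ y₁ x₂) j a b
      = z ^ (a : ℕ) * G (shiftPair y₀ x₁ y₁ x₂) j a b := by
  have he : ∀ a : Fin 4, (![0, 1, 1 + 1, 1 + 1 + 1] : Fin 4 → ℕ) a = a := by decide
  have h := hG.entry_eq (y₀ := y₀) (x₁ := x₁) (y₁ := y₁) (x₂ := x₂) 1 1 1 (fun z hz => by
    simpa only [pow_one, ← smul_shiftPair] using hS _ hX z hz) j a b b a
    (by rw [he, he, add_comm]) hz
  rwa [pow_one, ← smul_shiftPair] at h

theorem IsEquivariantOn.entry_diag (hG : IsEquivariantOn S G)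
    (hS : ∀ X ∈ S, ∀ z : ℂ, ‖z‖ ≤ 1 → z • X ∈ S) {y₀ x₁ y₁ x₂ : ℂ}
    (hX : shiftPair y₀ x₁ y₁ x₂ ∈ S) (j : Fin 2) (a : Fin 4) :
    G (shiftPair y₀ x₁ y₁ x₂) j a a = G 0 j a a := by
  have h := hG.entry_eq (y₀ := y₀) (x₁ := x₁) (y₁ := y₁) (x₂ := x₂) 1 1 1 (fun z hz => by
    simpa only [pow_one, ← smul_shiftPair] using hS _ hX z hz) j a a 0 0 rfl (z := 0) (by simp)
  simp only [pow_one, ← smul_shiftPair, zero_smul, pow_zero, one_mul] at h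
  exact h.symm

variable {η : ℂ}

/-- The `(3,1)` and `(2,0)` entries of an equivariant map at a pair of weighted shifts depend
linearly on the middle weights, and on the outer weight. -/
theorem IsEquivariantOn.exists_entry_eq (hG : IsEquivariantOn S G)
    (hS : ∀ y₀ x₁ y₁ x₂ : ℂ, ‖y₀‖ ≤ 1 → ‖x₁‖ ≤ 1 → ‖y₁‖ ≤ 1 → ‖x₂‖ ≤ 1 →
      η • shiftPair y₀ x₁ y₁ x₂ ∈ S) (j : Fin 2) :
    (∃ a d : ℂ, ∀ y₀ x₁ y₁ x₂ : ℂ, ‖y₀‖ ≤ 1 → ‖x₁‖ ≤ 1 → ‖y₁‖ ≤ 1 → ‖x₂‖ ≤ 1 →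
      G (η • shiftPair y₀ x₁ y₁ x₂) j 3 1 = x₂ * (a * x₁ + d * y₁)) ∧
    ∃ b e : ℂ, ∀ y₀ x₁ y₁ x₂ : ℂ, ‖y₀‖ ≤ 1 → ‖x₁‖ ≤ 1 → ‖y₁‖ ≤ 1 → ‖x₂‖ ≤ 1 →
      G (η • shiftPair y₀ x₁ y₁ x₂) j 2 0 = y₀ * (b * x₁ + e * y₁) := by
  have hmul : ∀ {z y : ℂ} (k : ℕ), ‖z‖ ≤ 1 → ‖y‖ ≤ 1 → ‖z ^ k * y‖ ≤ 1 := fun k hz hy => by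
    rw [norm_mul, norm_pow]
    exact mul_le_one₀ (pow_le_one₀ (norm_nonneg _) hz) (norm_nonneg _) hy
  have hscale : ∀ (k₀ k₁ k₂ : ℕ) (y₀ x₁ y₁ x₂ : ℂ), ‖y₀‖ ≤ 1 → ‖x₁‖ ≤ 1 → ‖y₁‖ ≤ 1 → ‖x₂‖ ≤ 1 →
      ∀ (a b : Fin 4) (q : ℕ), (![0, k₀, k₀ + k₁, k₀ + k₁ + k₂] : Fin 4 → ℕ) a
        = q + (![0, k₀, k₀ + k₁, k₀ + k₁ + k₂] : Fin 4 → ℕ) b → ∀ z : ℂ, ‖z‖ ≤ 1 →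
      G (η • shiftPair (z ^ k₀ * y₀) (z ^ k₁ * x₁) (z ^ k₁ * y₁) (z ^ k₂ * x₂)) j a b
      = z ^ q * G (η • shiftPair y₀ x₁ y₁ x₂) j a b := by
    intro k₀ k₁ k₂ y₀ x₁ y₁ x₂ h0 h1 h2 h3 a b q hq z hz
    have h := hG.entry_eq (y₀ := η * y₀) (x₁ := η * x₁) (y₁ := η * y₁) (x₂ := η * x₂) k₀ k₁ k₂
      (fun z hz => by
        have := hS (z ^ k₀ * y₀) (z ^ k₁ * x₁) (z ^ k₁ * y₁) (z ^ k₂ * x₂) (hmul _ hz h0)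
          (hmul _ hz h1) (hmul _ hz h2) (hmul _ hz h3)
        rw [smul_shiftPair] at this
        simpa only [mul_left_comm] using this) j a b 0 q (by rw [zero_add, hq]) hz
    rw [smul_shiftPair, smul_shiftPair]
    simpa only [mul_left_comm, pow_zero, one_mul] using h
  -- Joint homogeneity of degree one in (x₁, y₁), together with differentiability at the origin,
  -- gives linearity.
  have hlin : ∀ (y₀ x₂ : ℂ) (a b : Fin 4), ‖y₀‖ ≤ 1 → ‖x₂‖ ≤ 1 →
      (∀ q : ℂ × ℂ, ‖q.1‖ ≤ 1 → ‖q.2‖ ≤ 1 → ∀ z : ℂ, ‖z‖ ≤ 1 →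
        G (η • shiftPair y₀ (z * q.1) (z * q.2) x₂) j a b
          = z * G (η • shiftPair y₀ q.1 q.2 x₂) j a b) →
      ∃ c d : ℂ, ∀ x₁ y₁ : ℂ, ‖x₁‖ ≤ 1 → ‖y₁‖ ≤ 1 →
        G (η • shiftPair y₀ x₁ y₁ x₂) j a b = c * x₁ + d * y₁ := by
    intro y₀ x₂ a b h0 h3 hhom
    let g : ℂ × ℂ → ℂ := fun q => G (η • shiftPair y₀ q.1 q.2 x₂) j a b
    have hgd : DifferentiableAt ℂ g 0 := by
      have h1 : Differentiable ℂ fun q : ℂ × ℂ => η • shiftPair y₀ q.1 q.2 x₂ :=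
        (differentiable_shiftPair (by fun_prop) (by fun_prop) (by fun_prop)
          (by fun_prop)).const_smul η
      have h2 := (hG.differentiableAt (η • shiftPair y₀ 0 0 x₂)
        (hS _ _ _ _ h0 (by simp) (by simp) h3)).comp (0 : ℂ × ℂ) (h1 0)
      let L : MatTuple 2 4 →ₗ[ℂ] ℂ :=
        { toFun := fun X => X j a b, map_add' := fun _ _ => rfl, map_smul' := fun _ _ => rfl }
      exact (LinearMap.toContinuousLinearMap L).differentiableAt.comp _ h2
    refine ⟨fderiv ℂ g 0 (1, 0), fderiv ℂ g 0 (0, 1), fun x₁ y₁ h1 h2 => ?_⟩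
    have h4 : g (x₁, y₁) = fderiv ℂ g 0 (x₁, y₁) :=
      eq_fderiv_of_homogeneous hgd fun z hz => hhom (x₁, y₁) h1 h2 z hz
    have h5 : ((x₁, y₁) : ℂ × ℂ) = x₁ • (1, 0) + y₁ • (0, 1) := by simp
    rw [h5, map_add, map_smul, map_smul, ← h5] at h4
    simp only [smul_eq_mul] at h4
    rw [mul_comm _ x₁, mul_comm _ y₁]
    exact h4
  constructor
  · obtain ⟨c, d, hcd⟩ := hlin 0 1 3 1 (by simp) (by simp) fun q h1 h2 z hz => by
      simpa using hscale 0 1 0 0 q.1 q.2 1 (by simp) h1 h2 (by simp) 3 1 1 rfl z hz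
    refine ⟨c, d, fun y₀ x₁ y₁ x₂ h0 h1 h2 h3 => ?_⟩
    -- Degree zero in y₀, evaluated at z = 0, removes y₀; degree one in x₂ then reduces to x₂ = 1.
    have e1 := hscale 1 0 0 y₀ x₁ y₁ x₂ h0 h1 h2 h3 3 1 0 rfl 0 (by simp)
    have e2 := hscale 0 0 1 0 x₁ y₁ 1 (by simp) h1 h2 (by simp) 3 1 1 rfl x₂ h3
    simp only [pow_zero, pow_one, one_mul, zero_mul, mul_one, hcd x₁ y₁ h1 h2, mul_zero] at e1 e2
    rw [← e1, e2]
  · obtain ⟨c, d, hcd⟩ := hlin 1 0 2 0 (by simp) (by simp) fun q h1 h2 z hz => by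
      simpa using hscale 0 1 0 1 q.1 q.2 0 (by simp) h1 h2 (by simp) 2 0 1 rfl z hz
    refine ⟨c, d, fun y₀ x₁ y₁ x₂ h0 h1 h2 h3 => ?_⟩
    have e1 := hscale 0 0 1 y₀ x₁ y₁ x₂ h0 h1 h2 h3 2 0 0 rfl 0 (by simp)
    have e2 := hscale 1 0 0 1 x₁ y₁ 0 (by simp) h1 h2 (by simp) 2 0 1 rfl y₀ h0
    simp only [pow_zero, pow_one, one_mul, zero_mul, mul_one, hcd x₁ y₁ h1 h2, mul_zero] at e1 e2
    rw [← e1, e2]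

end Equivariant
end

/-! ### First variation at a boundary point -/

section Tangency

open Metric Set Filter Topology

variable {H K₁ K₂ : Type*} [NormedAddCommGroup H] [InnerProductSpace ℂ H]
  [NormedAddCommGroup K₁] [InnerProductSpace ℂ K₁] [NormedAddCommGroup K₂]
  [InnerProductSpace ℂ K₂] {T₁ : H →L[ℂ] K₁} {T₂ : H →L[ℂ] K₂}

/-- The form decouples: `V 1` sees only (x₁, y₀) and `V 2` only (x₂, y₁). Two contact points can
therefore be prescribed independently. -/
theorem blockForm_shiftPair (y₀ x₁ y₁ x₂ : ℂ) (V : Fin 4 → H) :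
    blockForm T₁ T₂ (shiftPair y₀ x₁ y₁ x₂) V
      = (‖x₁‖ ^ 2 * ‖T₁ (V 1)‖ ^ 2 + ‖y₀‖ ^ 2 * ‖T₂ (V 1)‖ ^ 2)
        + (‖x₂‖ ^ 2 * ‖T₁ (V 2)‖ ^ 2 + ‖y₁‖ ^ 2 * ‖T₂ (V 2)‖ ^ 2) := by
  simp only [blockForm, shiftPair, Fin.sum_univ_four, Matrix.cons_val_zero, Matrix.cons_val_one,
    Matrix.cons_val, Matrix.of_apply, zero_smul, star_zero, zero_add, add_zero, norm_zero,
    norm_smul, norm_star, mul_pow, ne_eq, OfNat.ofNat_ne_zero, not_false_eq_true, zero_pow]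
  ring

theorem hasDerivAt_sum_norm_sq {n : ℕ} {M : ℝ → Fin n → Fin n → ℂ} {Y : Fin n → Fin n → ℂ}
    (hM : ∀ a b, HasDerivAt (fun θ => M θ a b) (Y a b) 0) (w : Fin n → K₁) :
    HasDerivAt (fun θ => ∑ a, ‖∑ b, M θ a b • w b‖ ^ 2)
      (∑ a, 2 * (inner ℂ (∑ b, M 0 a b • w b) (∑ b, Y a b • w b)).re) 0 := by
  refine HasDerivAt.fun_sum fun a _ => ?_
  have h1 : HasDerivAt (fun θ => ∑ b, M θ a b • w b) (∑ b, Y a b • w b) 0 :=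
    HasDerivAt.fun_sum fun b _ => (hM a b).smul_const (w b)
  let _ : InnerProductSpace ℝ K₁ := InnerProductSpace.complexToReal
  exact HasDerivAt.norm_sq (F := K₁) h1

theorem hasDerivAt_blockForm {n : ℕ} {Z : ℝ → MatTuple 2 n} {Y : MatTuple 2 n}
    (hZ : ∀ j a b, HasDerivAt (fun θ => Z θ j a b) (Y j a b) 0) (V : Fin n → H) :
    HasDerivAt (fun θ => blockForm T₁ T₂ (Z θ) V)
      (∑ a, 2 * (inner ℂ (∑ b, Z 0 0 a b • T₁ (V b)) (∑ b, Y 0 a b • T₁ (V b))).re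
        + ∑ a, 2 * (inner ℂ (∑ b, star (Z 0 1 b a) • T₂ (V b))
          (∑ b, star (Y 1 b a) • T₂ (V b))).re) 0 :=
  (hasDerivAt_sum_norm_sq (fun a b => hZ 0 a b) fun b => T₁ (V b)).add
    (hasDerivAt_sum_norm_sq (M := fun θ a b => star (Z θ 1 b a)) (Y := fun a b => star (Y 1 b a))
      (fun a b => (hZ 1 b a).star) fun b => T₂ (V b))

theorem re_inner_smul_smul (a b : ℂ) (p q : H) :
    (inner ℂ (a • p) (b • q)).re = (star a * b * inner ℂ p q).re := by
  rw [inner_smul_left, inner_smul_right, RCLike.star_def, mul_assoc]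

theorem re_inner_smul_smul_symm (a b : ℂ) (p q : H) :
    (inner ℂ (a • p) (b • q)).re = (a * star b * inner ℂ q p).re := by
  rw [re_inner_smul_smul, ← Complex.conj_re]
  simp only [map_mul, RCLike.star_def, Complex.conj_conj, inner_conj_symm]

/-- The tangency condition at a boundary point given by weighted shifts. -/
theorem tangency {Z : ℝ → MatTuple 2 4} {Y : MatTuple 2 4}
    (hZ : ∀ j a b, HasDerivAt (fun θ => Z θ j a b) (Y j a b) 0) {y₀ x₁ y₁ x₂ : ℂ}
    (hZ0 : Z 0 = shiftPair y₀ x₁ y₁ x₂)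
    (hle : ∀ θ V, blockForm T₁ T₂ (Z θ) V ≤ ∑ b, ‖V b‖ ^ 2) {s₁ t₁ s₂ t₂ : ℝ} {u₁ u₂ : H}
    (h₁ : IsContact T₁ T₂ s₁ t₁ u₁) (h₂ : IsContact T₁ T₂ s₂ t₂ u₂) (hx₁ : ‖x₁‖ ^ 2 = s₁)
    (hy₀ : ‖y₀‖ ^ 2 = t₁) (hx₂ : ‖x₂‖ ^ 2 = s₂) (hy₁ : ‖y₁‖ ^ 2 = t₂) :
    (star x₂ * Y 0 3 1 + x₁ * star (Y 0 2 2)) * inner ℂ (T₁ u₂) (T₁ u₁)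
      + (star y₀ * Y 1 2 0 + y₁ * star (Y 1 1 1)) * inner ℂ (T₂ u₂) (T₂ u₁) = 0 := by
  set N := (star x₂ * Y 0 3 1 + x₁ * star (Y 0 2 2)) * inner ℂ (T₁ u₂) (T₁ u₁)
      + (star y₀ * Y 1 2 0 + y₁ * star (Y 1 1 1)) * inner ℂ (T₂ u₂) (T₂ u₁) with hN
  set D : ℂ := star x₁ * Y 0 2 1 * inner ℂ (T₁ u₁) (T₁ u₁)
    + star x₂ * Y 0 3 2 * inner ℂ (T₁ u₂) (T₁ u₂)
    + y₀ * star (Y 1 1 0) * inner ℂ (T₂ u₁) (T₂ u₁)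
    + y₁ * star (Y 1 2 1) * inner ℂ (T₂ u₂) (T₂ u₂) with hD
  have key : ∀ c : ℂ, ‖c‖ = 1 → D.re + (star c * N).re = 0 := by
    intro c hc
    have hcc : star c * c = 1 := by simp [Complex.conj_mul', hc]
    -- For every phase c this vector gives equality at θ = 0, so the derivative of the form along
    -- `Z` vanishes there. Only the cross terms between u₁ and u₂ depend on c.
    let V : Fin 4 → H := ![0, u₁, c • u₂, 0]
    have hmax : IsLocalMax (fun θ => blockForm T₁ T₂ (Z θ) V) 0 := by
      refine Eventually.of_forall fun θ => (hle θ V).trans (le_of_eq ?_)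
      simp only [hZ0]
      rw [blockForm_shiftPair, hx₁, hy₀, hx₂, hy₁]
      simp only [V, Fin.sum_univ_four, Matrix.cons_val_zero, Matrix.cons_val_one, Matrix.cons_val,
        map_smul, norm_smul, hc, one_mul, norm_zero]
      rw [h₁.eq, h₂.eq]
      ring
    have hd := hmax.hasDerivAt_eq_zero (hasDerivAt_blockForm hZ V)
    rw [hZ0] at hd
    simp only [V, shiftPair, Fin.sum_univ_four, Matrix.cons_val_zero, Matrix.cons_val_one,
      Matrix.cons_val, Matrix.of_apply, zero_smul, star_zero, zero_add, add_zero, map_zero,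
      smul_zero, inner_zero_left, Complex.zero_re, mul_zero, zero_mul, map_smul, smul_smul,
      inner_add_right, Complex.add_re] at hd
    rw [re_inner_smul_smul x₁, re_inner_smul_smul_symm x₁, re_inner_smul_smul (x₂ * c),
      re_inner_smul_smul (x₂ * c), re_inner_smul_smul (star y₀), re_inner_smul_smul_symm (star y₀),
      re_inner_smul_smul (star y₁ * c), re_inner_smul_smul (star y₁ * c)] at hd
    have hsum : D + star c * N
        = star x₁ * Y 0 2 1 * inner ℂ (T₁ u₁) (T₁ u₁)
          + x₁ * star (Y 0 2 2 * c) * inner ℂ (T₁ u₂) (T₁ u₁)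
          + (star (x₂ * c) * Y 0 3 1 * inner ℂ (T₁ u₂) (T₁ u₁)
            + star (x₂ * c) * (Y 0 3 2 * c) * inner ℂ (T₁ u₂) (T₁ u₂))
          + (star (star y₀) * star (Y 1 1 0) * inner ℂ (T₂ u₁) (T₂ u₁)
            + star y₀ * star (star (Y 1 2 0) * c) * inner ℂ (T₂ u₂) (T₂ u₁)
            + (star (star y₁ * c) * star (Y 1 1 1) * inner ℂ (T₂ u₂) (T₂ u₁)
              + star (star y₁ * c) * (star (Y 1 2 1) * c) * inner ℂ (T₂ u₂) (T₂ u₂))) := by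
      rw [hD, hN]
      simp only [star_mul', star_star]
      linear_combination -(star x₂ * Y 0 3 2 * inner ℂ (T₁ u₂) (T₁ u₂)
        + y₁ * star (Y 1 2 1) * inner ℂ (T₂ u₂) (T₂ u₂)) * hcc
    rw [← Complex.add_re, hsum]
    simp only [Complex.add_re]
    linarith
  -- The phases ±1 and ±i separate the real and imaginary parts of N from the constant term.
  have k1 := key 1 (by simp)
  have k2 := key (-1) (by simp)
  have k3 := key Complex.I (by simp)
  have k4 := key (-Complex.I) (by simp)
  simp at k1 k2 k3 k4
  apply Complex.ext
  · simp only [Complex.zero_re]; linarith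
  · simp only [Complex.zero_im]; linarith

end Tangency

/-! ### The transported rotation flow and its velocity field -/

noncomputable section

section Flow

open Metric Set Filter Topology

variable {g n : ℕ}

/-- Conjugation by `U` as a continuous linear map. -/
def tupleConjCLM (U : Matrix (Fin n) (Fin n) ℂ) : MatTuple g n →L[ℂ] MatTuple g n :=
  LinearMap.toContinuousLinearMap
    { toFun := tupleConj U
      map_add' := fun X Y => by funext j; simp [tupleConj, mul_add, add_mul]
      map_smul' := fun c X => by funext j; simp [tupleConj] }

theorem tupleConj_smul (U : Matrix (Fin n) (Fin n) ℂ) (c : ℂ) (X : MatTuple g n) :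
    tupleConj U (c • X) = c • tupleConj U X := (tupleConjCLM U).map_smul c X

theorem tupleConj_mem_freeSpectrahedronInt {ι : Type*} [Fintype ι] [DecidableEq ι]
    (A : Fin g → Matrix ι ι ℂ) {X : MatTuple g n} (hX : X ∈ freeSpectrahedronInt A n)
    {U : Matrix (Fin n) (Fin n) ℂ} (hU : U ∈ Matrix.unitaryGroup (Fin n) ℂ) :
    tupleConj U X ∈ freeSpectrahedronInt A n := by
  change (pencil A _).PosDef
  set W : Matrix (ι × Fin n) (ι × Fin n) ℂ := 1 ⊗ₖ U with hW
  have hUU : Uᴴ * U = 1 := Matrix.mem_unitaryGroup_iff'.1 hU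
  have hWW : Wᴴ * W = 1 := by
    rw [hW, Matrix.conjTranspose_kronecker, ← Matrix.mul_kronecker_mul, hUU,
      Matrix.conjTranspose_one, one_mul, Matrix.one_kronecker_one]
  have hlin : linPart A (tupleConj U X) = Wᴴ * linPart A X * W := by
    simp only [linPart, tupleConj, Finset.mul_sum, Finset.sum_mul, hW,
      Matrix.conjTranspose_kronecker, ← Matrix.mul_kronecker_mul, Matrix.conjTranspose_one,
      one_mul, mul_one]
  have hpen : pencil A (tupleConj U X) = Wᴴ * pencil A X * W := by
    simp only [pencil, hlin, Matrix.conjTranspose_mul, Matrix.conjTranspose_conjTranspose,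
      mul_sub, sub_mul, mul_one, hWW, mul_assoc]
  rw [hpen]
  refine Matrix.PosDef.conjTranspose_mul_mul_same hX ?_
  exact Function.LeftInverse.injective (g := fun v => Wᴴ *ᵥ v) fun v => by
    simp [Matrix.mulVec_mulVec, hWW]

/-- The rotation by `γ` of the target, transported to the source. -/
def rotationFlow (f h : (n : ℕ) → MatTuple g n → MatTuple g n) (n : ℕ) (γ : ℂ)
    (X : MatTuple g n) : MatTuple g n :=
  h n (γ • f n X)

/-- The velocity field of `rotationFlow`. -/
def rotationField (f h : (n : ℕ) → MatTuple g n → MatTuple g n) (n : ℕ)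
    (X : MatTuple g n) : MatTuple g n :=
  fderiv ℂ (h n) (f n X) (Complex.I • f n X)

variable {S T : GradedSet g} {f h : (n : ℕ) → MatTuple g n → MatTuple g n}

theorem rotationFlow_mem (hf : IsFreeAnalyticMap S T f) (hh : IsFreeAnalyticMap T S h)
    (hT : ∀ n, ∀ X ∈ T n, ∀ γ : ℂ, ‖γ‖ = 1 → γ • X ∈ T n) {γ : ℂ} (hγ : ‖γ‖ = 1)
    {X : MatTuple g n} (hX : X ∈ S n) : rotationFlow f h n γ X ∈ S n :=
  hh.mapsTo n (hT n _ (hf.mapsTo n hX) γ hγ)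

theorem rotationFlow_conj (hf : IsFreeAnalyticMap S T f) (hh : IsFreeAnalyticMap T S h)
    (hT : ∀ n, ∀ X ∈ T n, ∀ γ : ℂ, ‖γ‖ = 1 → γ • X ∈ T n) {γ : ℂ} (hγ : ‖γ‖ = 1)
    {X : MatTuple g n} (hX : X ∈ S n) {U : Matrix (Fin n) (Fin n) ℂ}
    (hU : U ∈ Matrix.unitaryGroup (Fin n) ℂ) :
    rotationFlow f h n γ (tupleConj U X) = tupleConj U (rotationFlow f h n γ X) := by
  unfold rotationFlow
  rw [hf.map_conj n X hX U hU, ← tupleConj_smul,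
    hh.map_conj n _ (hT n _ (hf.mapsTo n hX) γ hγ) U hU]

theorem rotationFlow_analytic (hf : IsFreeAnalyticMap S T f) (hh : IsFreeAnalyticMap T S h)
    (hT : ∀ n, ∀ X ∈ T n, ∀ γ : ℂ, ‖γ‖ = 1 → γ • X ∈ T n) {γ : ℂ} (hγ : ‖γ‖ = 1)
    (n : ℕ) : AnalyticOnNhd ℂ (rotationFlow f h n γ) (S n) := fun X hX =>
  AnalyticAt.comp (f := fun X => γ • f n X) (hh.analytic n _ (hT n _ (hf.mapsTo n hX) γ hγ))
    (analyticAt_const.fun_smul (hf.analytic n X hX))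

theorem hasDerivAt_rotationFlow (hf : IsFreeAnalyticMap S T f) (hh : IsFreeAnalyticMap T S h)
    {X : MatTuple g n} (hX : X ∈ S n) :
    HasDerivAt (fun θ : ℝ => rotationFlow f h n (Complex.exp (θ * Complex.I)) X)
      (rotationField f h n X) 0 := by
  have h1 : HasDerivAt (fun z : ℂ => Complex.exp (z * Complex.I)) Complex.I
      ((0 : ℝ) : ℂ) := by
    simpa using ((hasDerivAt_id ((0 : ℝ) : ℂ)).mul_const Complex.I).cexp
  have h2 : HasDerivAt (fun θ : ℝ => Complex.exp (θ * Complex.I) • f n X)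
      (Complex.I • f n X) 0 := h1.comp_ofReal.smul_const _
  have h3 : HasFDerivAt (h n) ((fderiv ℂ (h n) (f n X)).restrictScalars ℝ)
      (Complex.exp (((0 : ℝ) : ℂ) * Complex.I) • f n X) := by
    have : Complex.exp (((0 : ℝ) : ℂ) * Complex.I) • f n X = f n X := by simp
    rw [this]
    exact (hh.analytic n _ (hf.mapsTo n hX)).differentiableAt.hasFDerivAt.restrictScalars ℝ
  exact h3.comp_hasDerivAt (0 : ℝ) h2

theorem rotationField_conj (hf : IsFreeAnalyticMap S T f) (hh : IsFreeAnalyticMap T S h)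
    (hT : ∀ n, ∀ X ∈ T n, ∀ γ : ℂ, ‖γ‖ = 1 → γ • X ∈ T n)
    {X : MatTuple g n} (hX : X ∈ S n) {U : Matrix (Fin n) (Fin n) ℂ}
    (hU : U ∈ Matrix.unitaryGroup (Fin n) ℂ) (hUX : tupleConj U X ∈ S n) :
    rotationField f h n (tupleConj U X) = tupleConj U (rotationField f h n X) := by
  have h1 := hasDerivAt_rotationFlow hf hh hUX
  have h2 : HasDerivAt (fun θ : ℝ => tupleConjCLM U
      (rotationFlow f h n (Complex.exp (θ * Complex.I)) X))
      (tupleConjCLM U (rotationField f h n X)) 0 :=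
    ((tupleConjCLM U).restrictScalars ℝ).hasFDerivAt.comp_hasDerivAt (0 : ℝ)
      (hasDerivAt_rotationFlow hf hh hX)
  refine h1.unique (h2.congr_of_eventuallyEq (Eventually.of_forall fun θ => ?_))
  exact rotationFlow_conj hf hh hT (Complex.norm_exp_ofReal_mul_I θ) hX hU

theorem differentiableAt_rotationField (hf : IsFreeAnalyticMap S T f)
    (hh : IsFreeAnalyticMap T S h) {X : MatTuple g n} (hX : X ∈ S n) :
    DifferentiableAt ℂ (rotationField f h n) X := by
  have h1 := (hf.analytic n X hX).differentiableAt
  have h2 : DifferentiableAt ℂ (fderiv ℂ (h n)) (f n X) :=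
    (hh.analytic n _ (hf.mapsTo n hX)).fderiv.differentiableAt
  exact (h2.comp X h1).clm_apply (h1.const_smul Complex.I)

theorem rotationFlow_one (hinv : ∀ n, InvOn (h n) (f n) (S n) (T n)) {X : MatTuple g n}
    (hX : X ∈ S n) : rotationFlow f h n 1 X = X := by
  unfold rotationFlow
  rw [one_smul]
  exact (hinv n).1 hX

/-- The velocity field vanishes at `0` only if `f` maps `0` to `0`. -/
theorem eq_zero_of_rotationField_zero (hf : IsFreeAnalyticMap S T f)
    (hh : IsFreeAnalyticMap T S h) (hinv : ∀ n, InvOn (h n) (f n) (S n) (T n))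
    (hS : S n ∈ 𝓝 (0 : MatTuple g n)) (h0 : rotationField f h n 0 = 0) : f n 0 = 0 := by
  have h0S : (0 : MatTuple g n) ∈ S n := mem_of_mem_nhds hS
  have hf' := (hf.analytic n 0 h0S).differentiableAt.hasFDerivAt
  have hh' := (hh.analytic n _ (hf.mapsTo n h0S)).differentiableAt.hasFDerivAt
  have hcomp := hh'.comp (0 : MatTuple g n) hf'
  have hid : HasFDerivAt (h n ∘ f n) (ContinuousLinearMap.id ℂ (MatTuple g n)) 0 := by
    refine (hasFDerivAt_id (0 : MatTuple g n)).congr_of_eventuallyEq ?_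
    filter_upwards [hS] with X hX
    exact (hinv n).1 hX
  have heq := hcomp.unique hid
  have hsurj : Function.Surjective (fderiv ℂ (h n) (f n 0)).toLinearMap := by
    intro Y
    refine ⟨fderiv ℂ (f n) 0 Y, ?_⟩
    exact congrArg (fun L : MatTuple g n →L[ℂ] MatTuple g n => L Y) heq
  -- A right inverse of Dh(f(0)) suffices, by finite dimension.
  have hinj := LinearMap.injective_iff_surjective.2 hsurj
  have h1 : (fderiv ℂ (h n) (f n 0)).toLinearMap (Complex.I • f n 0) = 0 := h0
  have h2 := hinj (h1.trans (map_zero _).symm)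
  exact (smul_eq_zero.1 h2).resolve_left Complex.I_ne_zero

end Flow

end

/-! ### The map fixes the origin -/

section Origin

open Metric Set Filter Topology

variable {k m l : ℕ} {C₁ : Matrix (Fin k) (Fin m) ℂ} {C₂ : Matrix (Fin m) (Fin l) ℂ}
  {T : GradedSet 2} {f h : (n : ℕ) → MatTuple 2 n → MatTuple 2 n}

theorem blockForm_le_of_mem {n : ℕ} {X : MatTuple 2 n}
    (hX : X ∈ freeSpectrahedronInt (pairE C₁ C₂) n) (V : Fin n → EuclideanSpace ℂ (Fin m)) :
    blockForm (euclideanMap C₁) (euclideanMap C₂ᴴ) X V ≤ ∑ b, ‖V b‖ ^ 2 := by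
  rcases eq_or_ne V 0 with rfl | hV
  · simp [blockForm]
  · exact ((mem_freeSpectrahedronInt_pairE C₁ C₂ X).1 hX V hV).le

theorem smul_shiftPair_mem (hC₁ : ‖C₁‖ = 1) (hC₂ : ‖C₂‖ = 1) {y₀ x₁ y₁ x₂ : ℂ} (h0 : ‖y₀‖ ≤ 1)
    (h1 : ‖x₁‖ ≤ 1) (h2 : ‖y₁‖ ≤ 1) (h3 : ‖x₂‖ ≤ 1) :
    (1 / 10 : ℂ) • shiftPair y₀ x₁ y₁ x₂ ∈ freeSpectrahedronInt (pairE C₁ C₂) 4 := by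
  refine mem_pairE_of_entries_le hC₁ hC₂ fun j a b => ?_
  have h4 : ‖shiftPair y₀ x₁ y₁ x₂ j a b‖ ≤ 1 := by
    fin_cases j <;> fin_cases a <;> fin_cases b <;> simp [shiftPair, h0, h1, h2, h3]
  rw [Pi.smul_apply, Matrix.smul_apply, norm_smul]
  norm_num
  linarith

/-- A pair of weighted shifts with weights given by two contact points lies on the boundary. -/
theorem smul_shiftPair_mem_of_isContact {s₁ t₁ s₂ t₂ : ℝ} {u₁ u₂ : EuclideanSpace ℂ (Fin m)}
    (h₁ : IsContact (euclideanMap C₁) (euclideanMap C₂ᴴ) s₁ t₁ u₁)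
    (h₂ : IsContact (euclideanMap C₁) (euclideanMap C₂ᴴ) s₂ t₂ u₂) {y₀ x₁ y₁ x₂ : ℂ}
    (hx₁ : ‖x₁‖ ^ 2 = s₁) (hy₀ : ‖y₀‖ ^ 2 = t₁) (hx₂ : ‖x₂‖ ^ 2 = s₂) (hy₁ : ‖y₁‖ ^ 2 = t₂)
    {r : ℝ} (hr0 : 0 ≤ r) (hr : r < 1) :
    (r : ℂ) • shiftPair y₀ x₁ y₁ x₂ ∈ freeSpectrahedronInt (pairE C₁ C₂) 4 := by
  rw [mem_freeSpectrahedronInt_pairE]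
  intro V hV
  have hpos := sum_norm_sq_pos hV
  rw [smul_shiftPair, blockForm_shiftPair]
  simp only [norm_mul, mul_pow, hx₁, hy₀, hx₂, hy₁, Complex.norm_real, Real.norm_eq_abs, sq_abs]
  have e1 := h₁.le (V 1)
  have e2 := h₂.le (V 2)
  have e3 : ‖V 1‖ ^ 2 + ‖V 2‖ ^ 2 ≤ ∑ b, ‖V b‖ ^ 2 := by
    rw [Fin.sum_univ_four]
    linarith [sq_nonneg ‖V 0‖, sq_nonneg ‖V 3‖]
  have e4 : r ^ 2 < 1 := by nlinarith
  calc _ = r ^ 2 * ((s₁ * ‖euclideanMap C₁ (V 1)‖ ^ 2 + t₁ * ‖euclideanMap C₂ᴴ (V 1)‖ ^ 2)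
        + (s₂ * ‖euclideanMap C₁ (V 2)‖ ^ 2 + t₂ * ‖euclideanMap C₂ᴴ (V 2)‖ ^ 2)) := by ring
    _ ≤ r ^ 2 * ∑ b, ‖V b‖ ^ 2 := by gcongr; linarith
    _ < ∑ b, ‖V b‖ ^ 2 := by nlinarith

theorem IsContact.le_one {H K₁ K₂ : Type*} [NormedAddCommGroup H] [InnerProductSpace ℂ H]
    [NormedAddCommGroup K₁] [InnerProductSpace ℂ K₁] [NormedAddCommGroup K₂]
    [InnerProductSpace ℂ K₂] {T₁ : H →L[ℂ] K₁} {T₂ : H →L[ℂ] K₂} [FiniteDimensional ℂ H]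
    (hT₁ : ‖T₁‖ = 1) {s t : ℝ} {u : H} (h : IsContact T₁ T₂ s t u) : s ≤ 1 := by
  obtain ⟨e, he, hTe⟩ := exists_norm_eq_of_opNorm_eq_one hT₁
  have h1 := h.le e
  rw [hTe] at h1
  have h2 : 0 < ‖e‖ ^ 2 := by positivity
  nlinarith [mul_nonneg h.t_nonneg (sq_nonneg ‖T₂ e‖)]

theorem isEquivariantOn_rotationFlow
    (hf : IsFreeAnalyticMap (freeSpectrahedronInt (pairE C₁ C₂)) T f)
    (hh : IsFreeAnalyticMap T (freeSpectrahedronInt (pairE C₁ C₂)) h)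
    (hT : ∀ n, ∀ X ∈ T n, ∀ γ : ℂ, ‖γ‖ = 1 → γ • X ∈ T n)
    {γ : ℂ} (hγ : ‖γ‖ = 1) (n : ℕ) :
    IsEquivariantOn (freeSpectrahedronInt (pairE C₁ C₂) n) (rotationFlow f h n γ) :=
  ⟨fun X hX => (rotationFlow_analytic hf hh hT hγ n X hX).differentiableAt,
    fun _ hX _ hU => rotationFlow_conj hf hh hT hγ hX hU⟩

theorem isEquivariantOn_rotationField
    (hf : IsFreeAnalyticMap (freeSpectrahedronInt (pairE C₁ C₂)) T f)
    (hh : IsFreeAnalyticMap T (freeSpectrahedronInt (pairE C₁ C₂)) h)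
    (hT : ∀ n, ∀ X ∈ T n, ∀ γ : ℂ, ‖γ‖ = 1 → γ • X ∈ T n)
    (n : ℕ) :
    IsEquivariantOn (freeSpectrahedronInt (pairE C₁ C₂) n) (rotationField f h n) :=
  ⟨fun _ hX => differentiableAt_rotationField hf hh hX,
    fun _ hX _ hU => rotationField_conj hf hh hT hX hU
      (tupleConj_mem_freeSpectrahedronInt _ hX hU)⟩

/-- The velocity field is tangent to the boundary at pairs of weighted shifts. -/
theorem rotationField_tangency
    (hC₁ : ‖C₁‖ = 1) (hC₂ : ‖C₂‖ = 1)
    (hf : IsFreeAnalyticMap (freeSpectrahedronInt (pairE C₁ C₂)) T f)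
    (hh : IsFreeAnalyticMap T (freeSpectrahedronInt (pairE C₁ C₂)) h)
    (hT : ∀ n, ∀ X ∈ T n, ∀ γ : ℂ, ‖γ‖ = 1 → γ • X ∈ T n)
    (hinv : ∀ n, InvOn (h n) (f n) (freeSpectrahedronInt (pairE C₁ C₂) n) (T n))
    {s₁ t₁ s₂ t₂ : ℝ} {u₁ u₂ : EuclideanSpace ℂ (Fin m)}
    (h₁ : IsContact (euclideanMap C₁) (euclideanMap C₂ᴴ) s₁ t₁ u₁)
    (h₂ : IsContact (euclideanMap C₁) (euclideanMap C₂ᴴ) s₂ t₂ u₂) {y₀ x₁ y₁ x₂ : ℂ}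
    (hx₁ : ‖x₁‖ ^ 2 = s₁) (hy₀ : ‖y₀‖ ^ 2 = t₁) (hx₂ : ‖x₂‖ ^ 2 = s₂) (hy₁ : ‖y₁‖ ^ 2 = t₂)
    (n₀ : ‖y₀‖ ≤ 1) (n₁ : ‖x₁‖ ≤ 1) (n₂ : ‖y₁‖ ≤ 1) (n₃ : ‖x₂‖ ≤ 1) :
    (star x₂ * (100 * rotationField f h 4 ((1 / 10 : ℂ) • shiftPair y₀ x₁ y₁ x₂) 0 3 1)
        + x₁ * star (rotationField f h 4 0 0 2 2))
          * inner ℂ (euclideanMap C₁ u₂) (euclideanMap C₁ u₁)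
      + (star y₀ * (100 * rotationField f h 4 ((1 / 10 : ℂ) • shiftPair y₀ x₁ y₁ x₂) 1 2 0)
        + y₁ * star (rotationField f h 4 0 1 1 1))
          * inner ℂ (euclideanMap C₂ᴴ u₂) (euclideanMap C₂ᴴ u₁) = 0 := by
  set X := shiftPair y₀ x₁ y₁ x₂ with hX
  set η : ℂ := 1 / 10 with hη
  have hη0 : η ≠ 0 := by norm_num [hη]
  have hηX : η • X ∈ freeSpectrahedronInt (pairE C₁ C₂) 4 :=
    smul_shiftPair_mem hC₁ hC₂ n₀ n₁ n₂ n₃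
  have hbal : ∀ X ∈ freeSpectrahedronInt (pairE C₁ C₂) 4, ∀ z : ℂ, ‖z‖ ≤ 1 →
      z • X ∈ freeSpectrahedronInt (pairE C₁ C₂) 4 :=
    fun X hX z hz => smul_mem_freeSpectrahedronInt_pairE hX hz
  -- Substitute for the flow at the boundary point X: by homogeneity the (a, b) entry at X should be
  -- η ^ (b − a) times the entry at the interior point ηX.
  let Z : ℝ → MatTuple 2 4 := fun θ j => Matrix.of fun a b => (η ^ (b : ℕ) / η ^ (a : ℕ))
    * rotationFlow f h 4 (Complex.exp (θ * Complex.I)) (η • X) j a b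
  let Y : MatTuple 2 4 := fun j => Matrix.of fun a b => (η ^ (b : ℕ) / η ^ (a : ℕ))
    * rotationField f h 4 (η • X) j a b
  have hZ : ∀ j a b, HasDerivAt (fun θ => Z θ j a b) (Y j a b) 0 := by
    intro j a b
    have h1 := hasDerivAt_rotationFlow hf hh hηX
    let L : MatTuple 2 4 →ₗ[ℂ] ℂ :=
      { toFun := fun X => X j a b, map_add' := fun _ _ => rfl, map_smul' := fun _ _ => rfl }
    have h2 := ((LinearMap.toContinuousLinearMap L).restrictScalars ℝ).hasFDerivAt.comp_hasDerivAt
      (0 : ℝ) h1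
    exact h2.const_mul _
  have hZ0 : Z 0 = X := by
    have h1 : rotationFlow f h 4 (Complex.exp (((0 : ℝ) : ℂ) * Complex.I)) (η • X) = η • X := by
      simpa using rotationFlow_one hinv hηX
    ext j a b
    simp only [Z, h1, Matrix.of_apply]
    fin_cases j <;> fin_cases a <;> fin_cases b <;> simp [hX, shiftPair] <;> field_simp
  have hle : ∀ θ V, blockForm (euclideanMap C₁) (euclideanMap C₂ᴴ) (Z θ) V ≤ ∑ b, ‖V b‖ ^ 2 := by
    intro θ V
    -- For 1/10 < r < 1 this is the flow evaluated at rX, hence in the domain; letting r → 1 gives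
    -- the non-strict inequality for `Z θ`. The lower bound on r puts η / r in the unit disc, where
    -- homogeneity is available.
    let R : ℝ → MatTuple 2 4 := fun r j =>
      Matrix.of fun a b => ((r : ℂ) ^ (a : ℕ) / (r : ℂ) ^ (b : ℕ)) * Z θ j a b
    have hγ := Complex.norm_exp_ofReal_mul_I θ
    have halg : ∀ (e r A B : ℂ) (p q : ℕ), e ≠ 0 → r ≠ 0 →
        e ^ q / r ^ q * A = e ^ p / r ^ p * B → r ^ p / r ^ q * (e ^ q / e ^ p * A) = B := by
      intro e r A B p q he hr h1
      field_simp at h1 ⊢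
      linear_combination h1
    have hR : ∀ r : ℝ, 1 / 10 < r → r < 1 → R r ∈ freeSpectrahedronInt (pairE C₁ C₂) 4 := by
      intro r hr0 hr1
      have hrX : (r : ℂ) • X ∈ freeSpectrahedronInt (pairE C₁ C₂) 4 :=
        smul_shiftPair_mem_of_isContact h₁ h₂ hx₁ hy₀ hx₂ hy₁ (by linarith) hr1
      have hrne : (r : ℂ) ≠ 0 := Complex.ofReal_ne_zero.2 (by linarith)
      have heq : R r = rotationFlow f h 4 (Complex.exp (θ * Complex.I)) ((r : ℂ) • X) := by
        ext j a b
        have hz : ‖η / r‖ ≤ 1 := by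
          rw [norm_div, Complex.norm_real, Real.norm_eq_abs, abs_of_pos (by linarith),
            div_le_one (by linarith), hη]
          norm_num
          linarith
        have hrX' := hrX
        rw [hX, smul_shiftPair] at hrX'
        have h1 := (isEquivariantOn_rotationFlow hf hh hT hγ 4).entry_smul hbal hrX' j a b hz
        rw [← smul_shiftPair, ← hX, smul_smul, div_mul_cancel₀ _ hrne, div_pow η, div_pow η] at h1
        simp only [R, Z, Matrix.of_apply]
        exact halg _ _ _ _ _ _ hη0 hrne h1
      rw [heq]
      exact rotationFlow_mem hf hh hT hγ hrX
    have hcont : ContinuousAt (fun r : ℝ => blockForm (euclideanMap C₁) (euclideanMap C₂ᴴ) (R r) V)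
        1 := by
      have hent : ∀ j a b, ContinuousAt (fun r : ℝ => R r j a b) 1 := by
        intro j a b
        have : ContinuousAt (fun r : ℝ => ((r : ℂ) ^ (a : ℕ) / (r : ℂ) ^ (b : ℕ))) 1 :=
          ContinuousAt.div (by fun_prop) (by fun_prop) (by simp)
        exact this.mul continuousAt_const
      unfold blockForm
      refine ContinuousAt.add (tendsto_finsetSum _ fun a _ => ?_)
        (tendsto_finsetSum _ fun a _ => ?_)
      · refine (ContinuousAt.norm (tendsto_finsetSum _ fun b _ => ?_)).pow 2
        exact (hent 0 a b).smul continuousAt_const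
      · refine (ContinuousAt.norm (tendsto_finsetSum _ fun b _ => ?_)).pow 2
        exact (hent 1 b a).star.smul continuousAt_const
    have hR1 : R 1 = Z θ := by
      ext j a b
      simp [R]
    have hlim : Tendsto (fun r : ℝ => blockForm (euclideanMap C₁) (euclideanMap C₂ᴴ) (R r) V)
        (𝓝[<] 1) (𝓝 (blockForm (euclideanMap C₁) (euclideanMap C₂ᴴ) (Z θ) V)) := by
      rw [← hR1]
      exact hcont.tendsto.mono_left nhdsWithin_le_nhds
    refine le_of_tendsto hlim ?_
    filter_upwards [Ioo_mem_nhdsLT (show (1 / 10 : ℝ) < 1 by norm_num)] with r hr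
    exact blockForm_le_of_mem (hR r hr.1 hr.2) V
  have hηX' := hηX
  rw [hX, smul_shiftPair] at hηX'
  have hd := (isEquivariantOn_rotationField hf hh hT 4).entry_diag hbal hηX'
  rw [← smul_shiftPair, ← hX] at hd
  -- The entries (3, 1) and (2, 0) lie two steps below the diagonal, so the factor is η⁻² = 100.
  have e31 : Y 0 3 1 = 100 * rotationField f h 4 (η • X) 0 3 1 := by
    simp only [Y, Matrix.of_apply, hη]; norm_num
  have e20 : Y 1 2 0 = 100 * rotationField f h 4 (η • X) 1 2 0 := by
    simp only [Y, Matrix.of_apply, hη]; norm_num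
  have e22 : Y 0 2 2 = rotationField f h 4 0 0 2 2 := by
    simp only [Y, Matrix.of_apply, hd, div_self (pow_ne_zero _ hη0), one_mul]
  have e11 : Y 1 1 1 = rotationField f h 4 0 1 1 1 := by
    simp only [Y, Matrix.of_apply, hd, div_self (pow_ne_zero _ hη0), one_mul]
  have := tangency hZ (hZ0.trans hX) hle h₁ h₂ hx₁ hy₀ hx₂ hy₁
  rwa [e31, e20, e22, e11] at this

/-- The diagonal entries of the velocity field at `0` vanish. -/
theorem rotationField_zero_entries
    (hC₁ : ‖C₁‖ = 1) (hC₂ : ‖C₂‖ = 1)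
    (hf : IsFreeAnalyticMap (freeSpectrahedronInt (pairE C₁ C₂)) T f)
    (hh : IsFreeAnalyticMap T (freeSpectrahedronInt (pairE C₁ C₂)) h)
    (hT : ∀ n, ∀ X ∈ T n, ∀ γ : ℂ, ‖γ‖ = 1 → γ • X ∈ T n)
    (hinv : ∀ n, InvOn (h n) (f n) (freeSpectrahedronInt (pairE C₁ C₂) n) (T n))
    (hne : ∃ w, ‖w‖ ^ 2 < ‖euclideanMap C₁ w‖ ^ 2 + ‖euclideanMap C₂ᴴ w‖ ^ 2) :
    rotationField f h 4 0 0 2 2 = 0 ∧ rotationField f h 4 0 1 1 1 = 0 := by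
  have hT₁ : ‖euclideanMap C₁‖ = 1 := by rw [norm_euclideanMap, hC₁]
  have hT₂ : ‖euclideanMap C₂ᴴ‖ = 1 := by
    rw [norm_euclideanMap, Matrix.l2_opNorm_conjTranspose, hC₂]
  set α₁ := rotationField f h 4 0 0 2 2 with hα₁
  set α₂ := rotationField f h 4 0 1 1 1 with hα₂
  have heqv := isEquivariantOn_rotationField hf hh hT 4
  have hmem : ∀ y₀ x₁ y₁ x₂ : ℂ, ‖y₀‖ ≤ 1 → ‖x₁‖ ≤ 1 → ‖y₁‖ ≤ 1 → ‖x₂‖ ≤ 1 →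
      (1 / 10 : ℂ) • shiftPair y₀ x₁ y₁ x₂ ∈ freeSpectrahedronInt (pairE C₁ C₂) 4 :=
    fun y₀ x₁ y₁ x₂ h0 h1 h2 h3 => smul_shiftPair_mem hC₁ hC₂ h0 h1 h2 h3
  obtain ⟨a, d, had⟩ := (heqv.exists_entry_eq hmem 0).1
  obtain ⟨b, e, hbe⟩ := (heqv.exists_entry_eq hmem 1).2
  have hrel : ∀ s₁ t₁ u₁ s₂ t₂ u₂, IsContact (euclideanMap C₁) (euclideanMap C₂ᴴ) s₁ t₁ u₁ →
      IsContact (euclideanMap C₁) (euclideanMap C₂ᴴ) s₂ t₂ u₂ →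
      (0 < s₁ → (star α₁ + 100 * a * s₂) * inner ℂ (euclideanMap C₁ u₂) (euclideanMap C₁ u₁)
        + 100 * b * t₁ * inner ℂ (euclideanMap C₂ᴴ u₂) (euclideanMap C₂ᴴ u₁) = 0) ∧
      (0 < t₂ → (star α₂ + 100 * e * t₁) * inner ℂ (euclideanMap C₂ᴴ u₂) (euclideanMap C₂ᴴ u₁)
        + 100 * d * s₂ * inner ℂ (euclideanMap C₁ u₂) (euclideanMap C₁ u₁) = 0) := by
    intro s₁ t₁ u₁ s₂ t₂ u₂ h₁ h₂
    have hn : ∀ r : ℝ, 0 ≤ r → ‖((√r : ℝ) : ℂ)‖ ^ 2 = r := fun r hr => by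
      rw [Complex.norm_real, Real.norm_eq_abs, sq_abs, Real.sq_sqrt hr]
    have hn1 : ∀ r : ℝ, 0 ≤ r → r ≤ 1 → ‖((√r : ℝ) : ℂ)‖ ≤ 1 := fun r hr hr1 => by
      rw [Complex.norm_real, Real.norm_eq_abs, abs_of_nonneg (Real.sqrt_nonneg r)]
      exact Real.sqrt_le_one.2 hr1
    have hsq : ∀ r : ℝ, 0 ≤ r → star ((√r : ℝ) : ℂ) * ((√r : ℝ) : ℂ) = r := fun r hr => by
      rw [RCLike.star_def, Complex.conj_ofReal, ← Complex.ofReal_mul, Real.mul_self_sqrt hr]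
    have ms₁ := hn1 s₁ h₁.s_nonneg (h₁.le_one hT₁)
    have ms₂ := hn1 s₂ h₂.s_nonneg (h₂.le_one hT₁)
    have mt₁ := hn1 t₁ h₁.t_nonneg (h₁.swap.le_one hT₂)
    have mt₂ := hn1 t₂ h₂.t_nonneg (h₂.swap.le_one hT₂)
    have e1 := rotationField_tangency hC₁ hC₂ hf hh hT hinv h₁ h₂ (hn s₁ h₁.s_nonneg)
      (hn t₁ h₁.t_nonneg) (hn s₂ h₂.s_nonneg) (hn t₂ h₂.t_nonneg) mt₁ ms₁ mt₂ ms₂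
    -- Changing the sign of x₁ preserves all moduli. The difference of the two relations isolates
    -- the terms with x₁, which carry α₁; their sum isolates the terms with y₁, which carry α₂.
    have e2 := rotationField_tangency hC₁ hC₂ hf hh hT hinv h₁ h₂
      (x₁ := -((√s₁ : ℝ) : ℂ)) (by rw [norm_neg]; exact hn s₁ h₁.s_nonneg)
      (hn t₁ h₁.t_nonneg) (hn s₂ h₂.s_nonneg) (hn t₂ h₂.t_nonneg) mt₁ (by rwa [norm_neg]) mt₂ ms₂
    rw [had _ _ _ _ mt₁ ms₁ mt₂ ms₂, hbe _ _ _ _ mt₁ ms₁ mt₂ ms₂, ← hα₁, ← hα₂] at e1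
    rw [had _ _ _ _ mt₁ (by rwa [norm_neg]) mt₂ ms₂, hbe _ _ _ _ mt₁ (by rwa [norm_neg]) mt₂ ms₂,
      ← hα₁, ← hα₂] at e2
    have q1 := hsq s₂ h₂.s_nonneg
    have q2 := hsq t₁ h₁.t_nonneg
    set Hh := inner ℂ (euclideanMap C₁ u₂) (euclideanMap C₁ u₁)
    set Kk := inner ℂ (euclideanMap C₂ᴴ u₂) (euclideanMap C₂ᴴ u₁)
    constructor
    · intro hs
      have hne : ((√s₁ : ℝ) : ℂ) ≠ 0 := Complex.ofReal_ne_zero.2 (Real.sqrt_pos.2 hs).ne'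
      refine (mul_eq_zero.1 (?_ : ((√s₁ : ℝ) : ℂ) * _ = 0)).resolve_left hne
      linear_combination (e1 - e2) / 2 - 100 * ((√s₁ : ℝ) : ℂ) * a * Hh * q1
        - 100 * ((√s₁ : ℝ) : ℂ) * b * Kk * q2
    · intro ht
      have hne : ((√t₂ : ℝ) : ℂ) ≠ 0 := Complex.ofReal_ne_zero.2 (Real.sqrt_pos.2 ht).ne'
      refine (mul_eq_zero.1 (?_ : ((√t₂ : ℝ) : ℂ) * _ = 0)).resolve_left hne
      linear_combination (e1 + e2) / 2 - 100 * ((√t₂ : ℝ) : ℂ) * d * Hh * q1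
        - 100 * ((√t₂ : ℝ) : ℂ) * e * Kk * q2
  constructor
  · have := eq_zero_of_contact_relations hT₁ hT₂ hne (α := star α₁) (a := 100 * a) (b := 100 * b)
      fun s₁ t₁ u₁ s₂ t₂ u₂ h₁ h₂ hs => (hrel s₁ t₁ u₁ s₂ t₂ u₂ h₁ h₂).1 hs
    exact star_eq_zero.1 this
  · obtain ⟨w, hw⟩ := hne
    -- The second relation takes the form of the first once C₁ and C₂ᴴ, as well as the two contact
    -- points, are exchanged and everything is conjugated.
    refine eq_zero_of_contact_relations hT₂ hT₁ ⟨w, by linarith⟩ (α := α₂)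
      (a := star (100 * e)) (b := star (100 * d)) fun s₁ t₁ u₁ s₂ t₂ u₂ h₁ h₂ hs => ?_
    have := congrArg star ((hrel _ _ _ _ _ _ h₂.swap h₁.swap).2 hs)
    simp only [star_add, star_mul', star_star, star_zero] at this
    simp only [RCLike.star_def, Complex.conj_ofReal, inner_conj_symm, map_mul] at this ⊢
    exact this

/-- Sign changes kill the off-diagonal entries and transpositions equate the diagonal ones, so a
single diagonal entry decides. -/
theorem eq_zero_of_forall_tupleConj_eq {n : ℕ} {X : MatTuple 2 n}
    (hX : ∀ U ∈ Matrix.unitaryGroup (Fin n) ℂ, tupleConj U X = X) {j : Fin 2} {i : Fin n}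
    (hi : X j i i = 0) : X j = 0 := by
  have hoff : ∀ a b, a ≠ b → X j a b = 0 := by
    intro a b hab
    have h1 := hX (Matrix.diagonal fun c => if c = a then -1 else 1)
      (diagonal_mem_unitaryGroup fun c => by split_ifs <;> simp)
    have h2 := congrArg (fun Y : MatTuple 2 n => Y j a b) h1
    simp only [tupleConj_diagonal_apply, if_true, if_neg hab.symm, mul_one, star_neg,
      star_one, neg_mul, one_mul] at h2
    have h3 : (2 : ℂ) * X j a b = 0 := by linear_combination -h2
    simpa using h3
  have hdiag : ∀ a, X j a a = 0 := by
    intro a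
    let σ := Equiv.swap a i
    have hP : σ.permMatrix ℂ ∈ Matrix.unitaryGroup (Fin n) ℂ := by
      rw [Matrix.mem_unitaryGroup_iff', Matrix.star_eq_conjTranspose,
        Matrix.conjTranspose_permMatrix, ← Matrix.permMatrix_mul]
      simp
    have h1 := congrArg (fun Y : MatTuple 2 n => Y j a a) (hX _ hP)
    simp only [tupleConj, Matrix.conjTranspose_permMatrix] at h1
    rw [PEquiv.toMatrix_toPEquiv_mul, PEquiv.mul_toMatrix_toPEquiv] at h1
    simpa [σ, hi] using h1.symm
  ext a b
  rcases eq_or_ne a b with rfl | hab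
  · exact hdiag a
  · exact hoff a b hab

theorem apply_four_zero_eq_zero
    (hC₁ : ‖C₁‖ = 1) (hC₂ : ‖C₂‖ = 1)
    (hf : IsFreeAnalyticMap (freeSpectrahedronInt (pairE C₁ C₂)) T f)
    (hh : IsFreeAnalyticMap T (freeSpectrahedronInt (pairE C₁ C₂)) h)
    (hT : ∀ n, ∀ X ∈ T n, ∀ γ : ℂ, ‖γ‖ = 1 → γ • X ∈ T n)
    (hinv : ∀ n, InvOn (h n) (f n) (freeSpectrahedronInt (pairE C₁ C₂) n) (T n))
    (hne : ∃ w, ‖w‖ ^ 2 < ‖euclideanMap C₁ w‖ ^ 2 + ‖euclideanMap C₂ᴴ w‖ ^ 2) :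
    f 4 0 = 0 := by
  have h0 : (0 : MatTuple 2 4) ∈ freeSpectrahedronInt (pairE C₁ C₂) 4 :=
    zero_mem_freeSpectrahedronInt _
  refine eq_zero_of_rotationField_zero hf hh hinv (pairE_mem_nhds_zero hC₁ hC₂) ?_
  obtain ⟨h1, h2⟩ := rotationField_zero_entries hC₁ hC₂ hf hh hT hinv hne
  have hconj : ∀ U ∈ Matrix.unitaryGroup (Fin 4) ℂ,
      tupleConj U (rotationField f h 4 0) = rotationField f h 4 0 := by
    intro U hU
    rw [← (isEquivariantOn_rotationField hf hh hT 4).map_conj 0 h0 U hU]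
    congr 1
    exact (tupleConjCLM U).map_zero
  funext j
  fin_cases j
  · exact eq_zero_of_forall_tupleConj_eq hconj h1
  · exact eq_zero_of_forall_tupleConj_eq hconj h2

end Origin

/-! ### From a fixed origin to linearity -/

section Linear

open Metric Set Filter Topology

theorem tupleSum_zero {g n m : ℕ} :
    tupleSum (0 : MatTuple g n) (0 : MatTuple g m) = 0 := by
  funext j
  simp [tupleSum]

theorem tupleSum_smul {g n m : ℕ} (c : ℂ) (X : MatTuple g n) (Y : MatTuple g m) :
    tupleSum (c • X) (c • Y) = c • tupleSum X Y := by
  funext j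
  ext a b
  simp only [tupleSum, Matrix.reindex_apply, Matrix.submatrix_apply, Pi.smul_apply,
    Matrix.smul_apply]
  rcases finSumFinEquiv.symm a with a | a <;> rcases finSumFinEquiv.symm b with b | b <;> simp

theorem eq_zero_of_tupleSum_eq_zero {g n m : ℕ} {X : MatTuple g n} {Y : MatTuple g m}
    (h : tupleSum X Y = 0) : X = 0 := by
  funext j
  ext a b
  have := congrArg (fun Z : MatTuple g (n + m) =>
    Z j (finSumFinEquiv (.inl a)) (finSumFinEquiv (.inl b))) h
  simp only [tupleSum, Matrix.reindex_apply, Matrix.submatrix_apply,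
    Equiv.symm_apply_apply, Matrix.fromBlocks_apply₁₁] at this
  exact this

theorem single_diagonal_eq_tupleSum {g n m : ℕ} (k : Fin g) (d : Fin (n + m) → ℂ) :
    (Pi.single k (Matrix.diagonal d) : MatTuple g (n + m))
      = tupleSum (Pi.single k (Matrix.diagonal fun a => d (finSumFinEquiv (.inl a))))
          (Pi.single k (Matrix.diagonal fun a => d (finSumFinEquiv (.inr a)))) := by
  funext j
  rcases eq_or_ne j k with rfl | hj
  · simp only [tupleSum, Pi.single_eq_same, Matrix.fromBlocks_diagonal, Matrix.reindex_apply,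
      Matrix.submatrix_diagonal_equiv]
    congr 1
    funext a
    obtain ⟨p, rfl⟩ := finSumFinEquiv.surjective a
    rcases p with p | p <;> simp only [Function.comp, Equiv.symm_apply_apply, Sum.elim_inl,
      Sum.elim_inr]
  · simp [tupleSum, Pi.single_eq_of_ne hj]

/-- A graded family of linear maps that respects direct sums and unitary conjugation is given by a
scalar matrix. -/
theorem free_linear_eq {g : ℕ} (L : (n : ℕ) → MatTuple g n →ₗ[ℂ] MatTuple g n)
    (hsum : ∀ n m X Y, L (n + m) (tupleSum X Y) = tupleSum (L n X) (L m Y))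
    (hconj : ∀ n X, ∀ U ∈ Matrix.unitaryGroup (Fin n) ℂ,
      L n (tupleConj U X) = tupleConj U (L n X)) :
    ∃ M : Matrix (Fin g) (Fin g) ℂ, ∀ n X j, L n X j = ∑ k, M j k • X k := by
  -- The coefficients are read off at level one. Direct sums carry them to diagonal matrices, the
  -- spectral theorem to Hermitian ones, and real and imaginary parts to all matrices.
  let M : Matrix (Fin g) (Fin g) ℂ := Matrix.of fun j k => L 1 (Pi.single k 1) j 0 0
  have hone : ∀ (c : Fin 1 → ℂ) (j k), L 1 (Pi.single k (Matrix.diagonal c)) j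
      = M j k • Matrix.diagonal c := by
    intro c j k
    have h1 : (Pi.single k (Matrix.diagonal c) : MatTuple g 1) = c 0 • Pi.single k 1 := by
      rw [← Pi.single_smul]
      congr 1
      ext a b
      rw [Subsingleton.elim a 0, Subsingleton.elim b 0]
      simp
    rw [h1, map_smul]
    ext a b
    rw [Subsingleton.elim a 0, Subsingleton.elim b 0]
    simp [M, mul_comm]
  have hdiag : ∀ n (d : Fin n → ℂ) (j k), L n (Pi.single k (Matrix.diagonal d)) j
      = M j k • Matrix.diagonal d := by
    intro n
    induction n with
    | zero => intro d j k; ext a; exact a.elim0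
    | succ n ih =>
      intro d j k
      rw [single_diagonal_eq_tupleSum, hsum]
      have h2 := congrFun (single_diagonal_eq_tupleSum (g := g) (n := n) (m := 1) j d) j
      rw [Pi.single_eq_same] at h2
      rw [h2, ← Pi.smul_apply (M j k), ← tupleSum_smul]
      simp only [tupleSum, ih, hone, Pi.smul_apply, Pi.single_eq_same]
  have hherm : ∀ n (A : Matrix (Fin n) (Fin n) ℂ), A.IsHermitian → ∀ j k,
      L n (Pi.single k A) j = M j k • A := by
    intro n A hA j k
    set V : Matrix (Fin n) (Fin n) ℂ := hA.eigenvectorUnitary.1 with hV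
    have hVu : V ∈ Matrix.unitaryGroup (Fin n) ℂ := hA.eigenvectorUnitary.2
    have hAeq : A = Vᴴᴴ * Matrix.diagonal (RCLike.ofReal ∘ hA.eigenvalues) * Vᴴ := by
      rw [Matrix.conjTranspose_conjTranspose]
      conv_lhs => rw [hA.spectral_theorem]
      rfl
    have hVs : Vᴴ ∈ Matrix.unitaryGroup (Fin n) ℂ := Unitary.star_mem hVu
    have h1 : (Pi.single k A : MatTuple g n)
        = tupleConj Vᴴ (Pi.single k (Matrix.diagonal (RCLike.ofReal ∘ hA.eigenvalues))) := by
      funext i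
      rcases eq_or_ne i k with rfl | hi
      · simp only [tupleConj, Pi.single_eq_same]
        exact hAeq
      · simp [tupleConj, Pi.single_eq_of_ne hi]
    rw [h1, hconj n _ _ hVs]
    simp only [tupleConj, hdiag]
    rw [Matrix.mul_smul, Matrix.smul_mul, ← hAeq]
  have hall : ∀ n (A : Matrix (Fin n) (Fin n) ℂ) (j k), L n (Pi.single k A) j = M j k • A := by
    intro n A j k
    have h1 : A = (realPart A : Matrix (Fin n) (Fin n) ℂ) + Complex.I • (imaginaryPart A :
      Matrix (Fin n) (Fin n) ℂ) := (realPart_add_I_smul_imaginaryPart A).symm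
    have hr : (realPart A : Matrix (Fin n) (Fin n) ℂ).IsHermitian := (realPart A).2
    have hi : (imaginaryPart A : Matrix (Fin n) (Fin n) ℂ).IsHermitian := (imaginaryPart A).2
    rw [h1, Pi.single_add, Pi.single_smul, map_add, map_smul, Pi.add_apply, Pi.smul_apply,
      hherm n _ hr, hherm n _ hi, smul_add, smul_comm]
  refine ⟨M, fun n X j => ?_⟩
  conv_lhs => rw [← Finset.univ_sum_single X]
  rw [map_sum, Finset.sum_apply]
  exact Finset.sum_congr rfl fun k _ => hall n (X k) j k

variable {k m l : ℕ} {C₁ : Matrix (Fin k) (Fin m) ℂ} {C₂ : Matrix (Fin m) (Fin l) ℂ}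
  {T : GradedSet 2} {f h : (n : ℕ) → MatTuple 2 n → MatTuple 2 n}

theorem apply_zero_eq_zero
    (hf : IsFreeAnalyticMap (freeSpectrahedronInt (pairE C₁ C₂)) T f) (h4 : f 4 0 = 0) (n : ℕ) :
    f n 0 = 0 := by
  have hz : ∀ n, (0 : MatTuple 2 n) ∈ freeSpectrahedronInt (pairE C₁ C₂) n :=
    fun n => zero_mem_freeSpectrahedronInt _
  have h1 : f 1 0 = 0 := by
    have h2 := hf.map_sum 1 3 0 (hz 1) 0 (hz 3)
    rw [tupleSum_zero] at h2
    exact eq_zero_of_tupleSum_eq_zero (h2.symm.trans h4)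
  induction n with
  | zero => funext j; ext a; exact a.elim0
  | succ n ih =>
    have h2 := hf.map_sum n 1 0 (hz n) 0 (hz 1)
    rwa [tupleSum_zero, ih, h1, tupleSum_zero] at h2

/-- A biholomorphism onto a circular set that fixes the origin commutes with rotations. -/
theorem map_smul_of_norm_eq_one (hC₁ : ‖C₁‖ = 1) (hC₂ : ‖C₂‖ = 1)
    (hf : IsFreeAnalyticMap (freeSpectrahedronInt (pairE C₁ C₂)) T f)
    (hh : IsFreeAnalyticMap T (freeSpectrahedronInt (pairE C₁ C₂)) h)
    (hT : ∀ n, ∀ X ∈ T n, ∀ γ : ℂ, ‖γ‖ = 1 → γ • X ∈ T n)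
    (hinv : ∀ n, InvOn (h n) (f n) (freeSpectrahedronInt (pairE C₁ C₂) n) (T n)) {n : ℕ}
    (h0 : f n 0 = 0) {X : MatTuple 2 n} (hX : X ∈ freeSpectrahedronInt (pairE C₁ C₂) n) {γ : ℂ}
    (hγ : ‖γ‖ = 1) : f n (γ • X) = γ • f n X := by
  have hγ0 : γ ≠ 0 := by rintro rfl; simp at hγ
  have hS := pairE_mem_nhds_zero (n := n) hC₁ hC₂
  have h0S := mem_of_mem_nhds hS
  have hh0 : h n 0 = 0 := by
    have := (hinv n).1 h0S
    rwa [h0] at this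
  have hf' := (hf.analytic n 0 h0S).differentiableAt.hasFDerivAt
  have h0T : (0 : MatTuple 2 n) ∈ T n := by
    have := hf.mapsTo n h0S
    rwa [h0] at this
  have hh' := (hh.analytic n 0 h0T).differentiableAt.hasFDerivAt
  have hid : (fderiv ℂ (h n) 0).comp (fderiv ℂ (f n) 0)
      = ContinuousLinearMap.id ℂ (MatTuple 2 n) := by
    have hh'' : HasFDerivAt (h n) (fderiv ℂ (h n) 0) (f n 0) := by rw [h0]; exact hh'
    refine (hh''.comp (0 : MatTuple 2 n) hf').unique ?_
    refine (hasFDerivAt_id (0 : MatTuple 2 n)).congr_of_eventuallyEq ?_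
    filter_upwards [hS] with X hX
    exact (hinv n).1 hX
  have hd : HasFDerivAt (γ⁻¹ • rotationFlow f h n γ) (ContinuousLinearMap.id ℂ (MatTuple 2 n))
      0 := by
    have hh'' : HasFDerivAt (h n) (fderiv ℂ (h n) 0) (γ • f n 0) := by
      rw [h0, smul_zero]; exact hh'
    have h1 := (hh''.comp (0 : MatTuple 2 n) (hf'.const_smul γ)).const_smul γ⁻¹
    have h2 : γ⁻¹ • (fderiv ℂ (h n) 0).comp (γ • fderiv ℂ (f n) 0)
        = ContinuousLinearMap.id ℂ (MatTuple 2 n) := by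
      rw [ContinuousLinearMap.comp_smul, inv_smul_smul₀ hγ0, hid]
    rw [h2] at h1
    exact h1
  have hcar := cartan_uniqueness (convex_freeSpectrahedronInt (n := n) (pairE C₁ C₂)) hS
    -- Cartan's theorem is applied to X ↦ γ⁻¹h(γf(X)); the factor γ⁻¹ makes the derivative at 0 the
    -- identity, and the domain is balanced.
    (fun X hX => norm_le_one_of_mem_pairE hC₁ hC₂ hX)
    (ψ := γ⁻¹ • rotationFlow f h n γ)
    (fun X hX => (rotationFlow_analytic hf hh hT hγ n X hX).const_smul)
    (fun X hX => smul_mem_freeSpectrahedronInt_pairE (rotationFlow_mem hf hh hT hγ hX)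
      (by rw [norm_inv, hγ, inv_one]))
    (by simp [rotationFlow, h0, hh0]) hd X hX
  have h1 : h n (γ • f n X) = γ • X := by
    have h2 : γ⁻¹ • h n (γ • f n X) = X := hcar
    exact (inv_smul_eq_iff₀ hγ0).1 h2
  rw [← h1]
  exact (hinv n).2 (hT n _ (hf.mapsTo n hX) γ hγ)

theorem apply_eq_fderiv {n : ℕ}
    (hf : IsFreeAnalyticMap (freeSpectrahedronInt (pairE C₁ C₂)) T f)
    (hrot : ∀ X ∈ freeSpectrahedronInt (pairE C₁ C₂) n, ∀ γ : ℂ, ‖γ‖ = 1 →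
      f n (γ • X) = γ • f n X) {X : MatTuple 2 n}
    (hX : X ∈ freeSpectrahedronInt (pairE C₁ C₂) n) : f n X = fderiv ℂ (f n) 0 X := by
  refine eq_fderiv_of_homogeneous
    (hf.analytic n 0 (zero_mem_freeSpectrahedronInt _)).differentiableAt fun z hz => ?_
  have hF : Differentiable ℂ fun z : ℂ => z • X := by fun_prop
  have := eq_pow_smul_of_circle (G := fun z : ℂ => f n (z • X)) (c := f n X) (k := 1)
    (fun w hw => ((hf.analytic n _
      (smul_mem_freeSpectrahedronInt_pairE hX hw)).differentiableAt).comp w (hF w))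
    (fun w hw => by rw [pow_one]; exact hrot X hX w hw) hz
  simpa using this

/-- Any tuple enters the domain after scaling by a small c ≠ 0, so the compatibility of f with
direct sums and conjugation passes to its derivative on all tuples. -/
theorem isFreeLinearOn_of_eq_fderiv (hC₁ : ‖C₁‖ = 1) (hC₂ : ‖C₂‖ = 1)
    (hf : IsFreeAnalyticMap (freeSpectrahedronInt (pairE C₁ C₂)) T f)
    (hlin : ∀ n, ∀ X ∈ freeSpectrahedronInt (pairE C₁ C₂) n, f n X = fderiv ℂ (f n) 0 X) :
    IsFreeLinearOn (freeSpectrahedronInt (pairE C₁ C₂)) f := by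
  have hsmall : ∀ n (X : MatTuple 2 n),
      ∀ᶠ c : ℂ in 𝓝[≠] 0, c • X ∈ freeSpectrahedronInt (pairE C₁ C₂) n := by
    intro n X
    have hc : Continuous fun c : ℂ => c • X := by fun_prop
    refine (hc.tendsto 0).mono_left nhdsWithin_le_nhds |>.eventually_mem ?_
    rw [zero_smul]
    exact pairE_mem_nhds_zero hC₁ hC₂
  obtain ⟨M, hM⟩ := free_linear_eq (fun n => (fderiv ℂ (f n) 0 : MatTuple 2 n →ₗ[ℂ] MatTuple 2 n))
    (fun n m X Y => by
      obtain ⟨c, ⟨⟨h1, h2⟩, h3⟩, hc⟩ := (((hsmall n X).and (hsmall m Y)).and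
        (hsmall (n + m) (tupleSum X Y))).and self_mem_nhdsWithin |>.exists
      have hc0 : c ≠ 0 := hc
      have h4 := hf.map_sum n m _ h1 _ h2
      rw [tupleSum_smul, hlin _ _ h3, hlin _ _ h1, hlin _ _ h2, map_smul, map_smul, map_smul,
        tupleSum_smul] at h4
      exact smul_right_injective _ hc0 h4)
    (fun n X U hU => by
      obtain ⟨c, ⟨h1, h2⟩, hc⟩ := ((hsmall n X).and (hsmall n (tupleConj U X))).and
        self_mem_nhdsWithin |>.exists
      have hc0 : c ≠ 0 := hc
      have h4 := hf.map_conj n _ h1 U hU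
      rw [tupleConj_smul, hlin _ _ h2, hlin _ _ h1, map_smul, map_smul, tupleConj_smul] at h4
      exact smul_right_injective _ hc0 h4)
  refine ⟨M, fun n X hX j => ?_⟩
  rw [hlin n X hX]
  exact hM n X j

end Linear

theorem corollary1p2 {k m l : ℕ}
    (C₁ : Matrix (Fin k) (Fin m) ℂ) (C₂ : Matrix (Fin m) (Fin l) ℂ)
    (hC₁ : ‖C₁‖ = 1) (hC₂ : ‖C₂‖ = 1)
    (hE : freeSpectrahedronInt (pairE C₁ C₂) ≠ freeBidisk)
    {d : ℕ} (B : Fin 2 → Matrix (Fin d) (Fin d) ℂ)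
    (hB : IsCircular (freeSpectrahedron B))
    (f : (n : ℕ) → MatTuple 2 n → MatTuple 2 n)
    (hf : IsFreeBiholomorphism (freeSpectrahedronInt (pairE C₁ C₂)) (freeSpectrahedronInt B) f) :
    IsFreeLinearOn (freeSpectrahedronInt (pairE C₁ C₂)) f := by
  obtain ⟨hf, h, hh, hinv⟩ := hf
  have hT : ∀ n, ∀ X ∈ freeSpectrahedronInt B n, ∀ γ : ℂ, ‖γ‖ = 1 →
      γ • X ∈ freeSpectrahedronInt B n :=
    fun n X hX γ hγ => smul_mem_freeSpectrahedronInt_of_isCircular hB hX hγ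
  have hne : ∃ w, ‖w‖ ^ 2 < ‖euclideanMap C₁ w‖ ^ 2 + ‖euclideanMap C₂ᴴ w‖ ^ 2 := by
    by_contra! hle
    exact hE (freeSpectrahedronInt_pairE_eq_freeBidisk hC₁ hC₂ hle)
  have h0 := apply_zero_eq_zero hf (apply_four_zero_eq_zero hC₁ hC₂ hf hh hT hinv hne)
  exact isFreeLinearOn_of_eq_fderiv hC₁ hC₂ hf fun n X hX => apply_eq_fderiv hf
    (fun X hX γ hγ => map_smul_of_norm_eq_one hC₁ hC₂ hf hh hT hinv (h0 n) hX hγ) hX
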